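/- Corollary 4.2 (finiteness of rich triangulations). All simplicial complexes are abstract and finite (a simplex is determined by its set of vertices). Fix an integral domain $R$ of coefficients, for example $R=\mathbb{Z}$. A finite simplicial complex $K$ is a *closed $n$-dimensional homology manifold* if for every simplex $\sigma$ of $K$, of dimension $k$ say, one has $k\le n$ and the link of $\sigma$ in $K$ has the same reduced simplicial homology with coefficients in $R$ as the sphere $S^{n-k-1}$ (where $S^{-1}=\emptyset$). A *triangulation* of a topological space $M$ as a closed $n$-dimensional homology manifold is a simplicial complex $K$ of this kind whose underlying space $|K|$ is homeomorphic to $M$. The triangulation $K$ is *rich* if the link of each $(n-2)$-dimensional simplex of $K$ is a loop (a triangulated circle) of length at least $5$. It is *flag-no-square* if each non-empty set of vertices of $K$ that are pairwise connected by edges spans a simplex, and if each simplicial loop of length four in $K$ has a diagonal, i.e. a pair of opposite vertices of the loop spans an edge. Let $M$ be a closed $4$-dimensional homology manifold, i.e. a topological space that admits triangulations as a closed $4$-dimensional homology manifold. Then, up to isomorphism of simplicial complexes, $M$ has only finitely many rich triangulations. In particular, up to isomorphism of simplicial complexes, $M$ has only finitely many flag-no-square triangulations. -/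

import Mathlib

namespace HomologyManifold

/-- The link of `σ` in `K`: the simplices `τ` disjoint from `σ` such that `σ ∪ τ` is a simplex
of `K`. It is a complex on the same vertex type, but not every element of `V` need be one of its
vertices. -/
def link {V : Type*} [DecidableEq V] (K : AbstractSimplicialComplex V) (σ : Finset V) :
    PreAbstractSimplicialComplex V where
  faces := {τ | τ.Nonempty ∧ Disjoint σ τ ∧ σ ∪ τ ∈ K.faces}
  isRelLowerSet_faces := fun _ hτ => ⟨hτ.1, fun _ hρ hne =>
    ⟨hne, hτ.2.1.mono_right hρ,
      (K.isRelLowerSet_faces hτ.2.2).2 (Finset.union_subset_union_right hρ)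
        (hne.mono Finset.subset_union_right)⟩⟩

/-! ### Reduced simplicial homology

A simplex is oriented by the order of its vertices. Degrees are shifted by one: degree `j` is
spanned by the simplices with `j` vertices, so that degree `0` of the complex is the augmentation,
spanned by the empty simplex. The homology does not depend on the linear order of `V`, up to
isomorphism. -/

/-- The sign with which `s.erase v` occurs in the boundary of `s`: it is `(-1) ^ i` if `v` is the
`i`-th vertex of `s` (counted from `0`). -/
def faceSign (R : Type*) [CommRing R] {V : Type*} [LinearOrder V] (s : Finset V) (v : V) : R :=
  (-1) ^ (s.filter (fun w => w < v)).card

/-- The simplicial boundary operator `∂ s = ∑ i, (-1) ^ i (s without its i-th vertex)`. -/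
noncomputable def boundary (R : Type*) [CommRing R] (V : Type*) [LinearOrder V] :
    (Finset V →₀ R) →ₗ[R] (Finset V →₀ R) :=
  Finsupp.linearCombination R
    (fun s : Finset V => ∑ v ∈ s, Finsupp.single (s.erase v) (faceSign R s v))

/-- The augmented simplicial chains of `L` spanned by the simplices with `j` vertices (the empty
simplex if `j = 0`), that is, the chains of dimension `j - 1`. -/
noncomputable def chains (R : Type*) [CommRing R] {V : Type*}
    (L : PreAbstractSimplicialComplex V) (j : ℕ) : Submodule R (Finset V →₀ R) :=
  Finsupp.supported R R {s | s.card = j ∧ (s = ∅ ∨ s ∈ L.faces)}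

/-- The reduced cycles of dimension `j - 1`. -/
noncomputable def cycles (R : Type*) [CommRing R] {V : Type*} [LinearOrder V]
    (L : PreAbstractSimplicialComplex V) (j : ℕ) : Submodule R (Finset V →₀ R) :=
  chains R L j ⊓ LinearMap.ker (boundary R V)

/-- The boundaries of dimension `j - 1`. -/
noncomputable def boundaries (R : Type*) [CommRing R] {V : Type*} [LinearOrder V]
    (L : PreAbstractSimplicialComplex V) (j : ℕ) : Submodule R (Finset V →₀ R) :=
  (chains R L (j + 1)).map (boundary R V)

/-- The reduced simplicial homology of `L` in dimension `j - 1`, with coefficients in `R`: cycles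
modulo boundaries, as the submodule of classes of cycles in the quotient of all chains by the
boundaries. -/
noncomputable abbrev reducedHomology (R : Type*) [CommRing R] {V : Type*} [LinearOrder V]
    (L : PreAbstractSimplicialComplex V) (j : ℕ) :
    Submodule R ((Finset V →₀ R) ⧸ boundaries R L j) :=
  (cycles R L j).map (boundaries R L j).mkQ

theorem boundary_single {R : Type*} [CommRing R] {V : Type*} [LinearOrder V]
    (s : Finset V) (r : R) :
    boundary R V (Finsupp.single s r) =
      ∑ v ∈ s, Finsupp.single (s.erase v) (r * faceSign R s v) := by
  simp [boundary, Finsupp.linearCombination_single, Finset.smul_sum]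

theorem faceSign_erase {R : Type*} [CommRing R] {V : Type*} [LinearOrder V]
    {s : Finset V} {v w : V} (hv : v ∈ s) (hw : w ∈ s) (hvw : v ≠ w) :
    faceSign R s v * faceSign R (s.erase v) w + faceSign R s w * faceSign R (s.erase w) v = 0 := by
  wlog h : v < w generalizing v w with H
  · rw [add_comm]
    exact H hw hv hvw.symm (lt_of_le_of_ne (not_lt.mp h) hvw.symm)
  have h1 : (s.erase v).filter (fun x => x < w) = (s.filter (fun x => x < w)).erase v := by
    ext x; simp only [Finset.mem_filter, Finset.mem_erase]; tauto
  have h2 : (s.erase w).filter (fun x => x < v) = s.filter (fun x => x < v) := by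
    ext x; simp only [Finset.mem_filter, Finset.mem_erase]
    constructor
    · rintro ⟨⟨_, hx⟩, hxv⟩; exact ⟨hx, hxv⟩
    · rintro ⟨hx, hxv⟩; exact ⟨⟨(hxv.trans h).ne, hx⟩, hxv⟩
  have h3 : ((s.filter (fun x => x < w)).erase v).card + 1 = (s.filter (fun x => x < w)).card :=
    Finset.card_erase_add_one (by simp [hv, h])
  unfold faceSign
  rw [h1, h2, ← h3, pow_succ]
  ring

/-- The augmented simplicial chains form a complex. -/
theorem boundary_boundary {R : Type*} [CommRing R] {V : Type*} [LinearOrder V]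
    (c : Finset V →₀ R) : boundary R V (boundary R V c) = 0 := by
  induction c using Finsupp.induction_linear with
  | zero => simp
  | add f g hf hg => simp [hf, hg]
  | single s r =>
    rw [boundary_single, map_sum]
    simp only [boundary_single]
    rw [Finset.sum_sigma']
    refine Finset.sum_involution (fun p _ => ⟨p.2, p.1⟩) ?_ ?_ ?_ ?_
    · rintro ⟨v, w⟩ h
      simp only [Finset.mem_sigma, Finset.mem_erase] at h
      have := faceSign_erase (R := R) h.1 h.2.2 h.2.1.symm
      rw [Finset.erase_right_comm, ← Finsupp.single_add, mul_assoc, mul_assoc, ← mul_add, this]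
      simp
    · rintro ⟨v, w⟩ h _ h'
      simp only [Finset.mem_sigma, Finset.mem_erase] at h
      exact h.2.1 (congrArg Sigma.fst h')
    · rintro ⟨v, w⟩ h
      simp only [Finset.mem_sigma, Finset.mem_erase] at h ⊢
      exact ⟨h.2.2, h.2.1.symm, h.1⟩
    · rintro ⟨v, w⟩ _
      rfl

/-- Boundaries are cycles. -/
theorem boundaries_le_cycles {R : Type*} [CommRing R] {V : Type*} [LinearOrder V]
    (L : PreAbstractSimplicialComplex V) (j : ℕ) : boundaries R L j ≤ cycles R L j := by
  refine le_inf ?_ ?_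
  · rw [boundaries, chains, Finsupp.supported_eq_span_single, Submodule.map_span_le]
    rintro _ ⟨s, ⟨hs, hL⟩, rfl⟩
    rw [boundary_single]
    refine Submodule.sum_mem _ fun v hv => Finsupp.single_mem_supported R _ ⟨?_, ?_⟩
    · rw [Finset.card_erase_of_mem hv, hs]; rfl
    · rcases hL with rfl | hL
      · simp at hv
      · rcases (s.erase v).eq_empty_or_nonempty with h | h
        · exact Or.inl h
        · exact Or.inr ((L.isRelLowerSet_faces hL).2 (Finset.erase_subset v s) h)
  · rintro _ ⟨c, -, rfl⟩
    exact LinearMap.mem_ker.mpr (boundary_boundary c)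

/-! ### Homology manifolds and their triangulations -/

/-- A finite simplicial complex `K` is a closed `n`-dimensional homology manifold (over `R`) if
the link of each simplex `σ`, say of dimension `k`, has the homology of the sphere of dimension
`n - k - 1` (the empty complex, for `k = n`). With `σ.card = k + 1`, the reduced homology of this
sphere is `R` in the shifted degree `j = n - k` and zero otherwise. -/
def IsClosedHomologyManifold (R : Type*) [CommRing R] (n : ℕ) {V : Type*} [Fintype V]
    [LinearOrder V] (K : AbstractSimplicialComplex V) : Prop :=
  ∀ σ ∈ K.faces, σ.card ≤ n + 1 ∧ ∀ j : ℕ,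
    (j + σ.card = n + 1 → Nonempty (reducedHomology R (link K σ) j ≃ₗ[R] R)) ∧
    (j + σ.card ≠ n + 1 → Subsingleton (reducedHomology R (link K σ) j))

/-- The underlying space `|K|` of a finite simplicial complex, in barycentric coordinates. -/
def underlyingSpace {V : Type*} [Fintype V] (K : AbstractSimplicialComplex V) : Set (V → ℝ) :=
  {x | x ∈ stdSimplex ℝ V ∧ ∃ s ∈ K.faces, ∀ v, x v ≠ 0 → v ∈ s}

/-- `K` is a triangulation of the closed `n`-dimensional homology manifold `M`. -/
structure IsTriangulation (R : Type*) [CommRing R] (n : ℕ) {V : Type*} [Fintype V]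
    [LinearOrder V] (K : AbstractSimplicialComplex V) (M : Type*) [TopologicalSpace M] : Prop where
  isClosedHomologyManifold : IsClosedHomologyManifold R n K
  homeomorphic : Nonempty (underlyingSpace K ≃ₜ M)

/-- The simplicial complex `L` is a loop of length `m`. -/
def IsLoop {V : Type*} [DecidableEq V] (L : PreAbstractSimplicialComplex V) (m : ℕ) : Prop :=
  3 ≤ m ∧ ∃ v : ZMod m → V, Function.Injective v ∧
    ∀ s : Finset V, s ∈ L.faces ↔ ∃ i : ZMod m, s = {v i} ∨ s = {v i, v (i + 1)}

/-- A triangulation of a closed `n`-dimensional homology manifold is rich if the links of all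
`(n - 2)`-dimensional simplices (all are interior, since there is no boundary) are loops of length
at least `5`. -/
def IsRich (n : ℕ) {V : Type*} [DecidableEq V] (K : AbstractSimplicialComplex V) : Prop :=
  ∀ σ ∈ K.faces, σ.card + 1 = n → ∃ m : ℕ, 5 ≤ m ∧ IsLoop (link K σ) m

/-- Two distinct vertices span an edge of `K`. -/
def IsEdge {V : Type*} [DecidableEq V] (K : AbstractSimplicialComplex V) (a b : V) : Prop :=
  a ≠ b ∧ {a, b} ∈ K.faces

/-- Every nonempty finite set of vertices pairwise connected by edges spans a simplex, and every
loop of length four has a diagonal. -/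
def IsFlagNoSquare {V : Type*} [DecidableEq V] (K : AbstractSimplicialComplex V) : Prop :=
  (∀ s : Finset V, s.Nonempty → (∀ a ∈ s, ∀ b ∈ s, a ≠ b → IsEdge K a b) → s ∈ K.faces) ∧
  (∀ a b c d : V, a ≠ c → b ≠ d →
    IsEdge K a b → IsEdge K b c → IsEdge K c d → IsEdge K d a → IsEdge K a c ∨ IsEdge K b d)

/-- `K` and `L` are isomorphic simplicial complexes. -/
def Isomorphic {V W : Type*} (K : AbstractSimplicialComplex V)
    (L : AbstractSimplicialComplex W) : Prop :=
  ∃ e : V ≃ W, ∀ s : Finset V, s ∈ K.faces ↔ s.map e.toEmbedding ∈ L.faces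

end HomologyManifold

/-! The Euler characteristic bounds the number of vertices, and there are finitely many complexes on
boundedly many vertices. Let `f_i` be the number of simplices with `i` vertices. The link of a
simplex with four vertices has the homology of two points, so `5 f_5 = 2 f_4`. The link of an edge
has the homology of a 2-sphere; summing its Euler characteristic over all edges gives `2 f_2 + 6 f_4
= 3 f_3 + 10 f_5`. Eliminating `f_2` and `f_4` leaves `χ = f_1 - f_3 / 2 + f_5`. If every triangle
lies in at least five 4-simplices, then `5 f_3 ≤ 10 f_5`, hence `f_1 ≤ χ`; this is
`card_le_of_five_le_card_cofaces`. Richness gives the hypothesis on triangles directly. In the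
flag-no-square case the link of a triangle is a nonempty 2-regular graph without 3-cycles or
4-cycles, so it has at least five vertices, and as many edges.

It remains to bound `χ` over all triangulations of `M`. Full topological invariance of homology is
not needed: it is enough to bound the Betti numbers of `K` in terms of one fixed reference
triangulation `L` (`finrank_reducedHomology_le`). For this, `exists_linearMap_ker_le_boundaries`
builds a linear simplicial approximation `F` from the cycles of `K` to ordered chains on the
vertices of `L`: place a cycle in the underlying space, subdivide it, move the points by the
homeomorphism, and replace each point by a vertex with maximal barycentric coordinate. A cycle
killed by `F` is a boundary, so the Betti number is at most the number of short lists of vertices of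
`L`.

The chains in between are formal combinations of lists of points, of two kinds: affine lists, whose
points share a closed simplex and which can be subdivided, and small lists, whose points are close
together and which can be moved by any uniformly continuous map. Truncating small coordinates turns
small lists into affine ones; prism operators and subdivision supply all homotopies. -/

namespace HomologyManifold

/-! ### Ordered chains -/

section OrderedChains

variable {R : Type*} [CommRing R] {E F G : Type*}

/-- A linear map out of finitely supported functions respects supports if it does so on the
basis. -/
theorem map_mem_of_mem_supported {α M : Type*} [AddCommGroup M] [Module R M]
    (A : (α →₀ R) →ₗ[R] M) {P : Set α} {Q : Submodule R M}
    (h : ∀ a ∈ P, A (Finsupp.single a 1) ∈ Q) {c : α →₀ R}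
    (hc : c ∈ Finsupp.supported R R P) : A c ∈ Q := by
  rw [Finsupp.supported_eq_span_single] at hc
  have : Submodule.span R ((fun i => Finsupp.single i (1 : R)) '' P) ≤ Q.comap A := by
    rw [Submodule.span_le]
    rintro _ ⟨a, ha, rfl⟩
    exact h a ha
  exact this hc

/-- The cone with apex `a`, which puts `a` in front of every list. -/
noncomputable def cone (R : Type*) [CommRing R] {E : Type*} (a : E) :
    (List E →₀ R) →ₗ[R] (List E →₀ R) :=
  Finsupp.lmapDomain R R (List.cons a)

@[simp] theorem cone_single (a : E) (l : List E) (r : R) :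
    cone R a (Finsupp.single l r) = Finsupp.single (a :: l) r := by
  simp [cone]

/-- The boundary of an ordered simplex. -/
noncomputable def listBoundary (R : Type*) [CommRing R] {E : Type*} : List E → (List E →₀ R)
  | [] => 0
  | a :: l => Finsupp.single l 1 - cone R a (listBoundary R l)

/-- The boundary operator of the augmented complex of ordered chains. -/
noncomputable def orderedBoundary (R : Type*) [CommRing R] (E : Type*) :
    (List E →₀ R) →ₗ[R] (List E →₀ R) :=
  Finsupp.linearCombination R (listBoundary R)

@[simp] theorem orderedBoundary_nil (r : R) :
    orderedBoundary R E (Finsupp.single [] r) = 0 := by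
  simp [orderedBoundary, listBoundary]

/-- Coning is a contracting homotopy. Together with induction on the list, this identity replaces
all computations with alternating sums. -/
theorem orderedBoundary_cone (a : E) (c : List E →₀ R) :
    orderedBoundary R E (cone R a c) = c - cone R a (orderedBoundary R E c) := by
  induction c using Finsupp.induction_linear with
  | zero => simp
  | add f g hf hg => simp only [map_add, hf, hg]; abel
  | single l r =>
    simp [orderedBoundary, listBoundary, smul_sub]

theorem orderedBoundary_cons (a : E) (l : List E) (r : R) :
    orderedBoundary R E (Finsupp.single (a :: l) r) =
      Finsupp.single l r - cone R a (orderedBoundary R E (Finsupp.single l r)) := by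
  rw [← cone_single, orderedBoundary_cone]

theorem orderedBoundary_orderedBoundary (c : List E →₀ R) :
    orderedBoundary R E (orderedBoundary R E c) = 0 := by
  induction c using Finsupp.induction_linear with
  | zero => simp
  | add f g hf hg => simp [hf, hg]
  | single l r =>
    induction l with
    | nil => simp
    | cons a l ih => rw [orderedBoundary_cons, map_sub, orderedBoundary_cone, ih]; simp

theorem cone_mem_supported {a : E} {P Q : Set (List E)} (h : ∀ l ∈ P, a :: l ∈ Q)
    {c : List E →₀ R} (hc : c ∈ Finsupp.supported R R P) :
    cone R a c ∈ Finsupp.supported R R Q :=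
  map_mem_of_mem_supported _ (fun l hl => by
    rw [cone_single]; exact Finsupp.single_mem_supported R _ (h l hl)) hc

theorem orderedBoundary_single_mem_supported (l : List E) :
    orderedBoundary R E (Finsupp.single l 1) ∈
      Finsupp.supported R R {m | m.length + 1 = l.length ∧ m ⊆ l} := by
  induction l with
  | nil => simp
  | cons a l ih =>
    rw [orderedBoundary_cons]
    refine Submodule.sub_mem _ (Finsupp.single_mem_supported R _ (by simp)) ?_
    refine cone_mem_supported (fun m hm => ?_) ih
    exact ⟨by simp [hm.1], List.cons_subset_cons a hm.2⟩

/-- The map of ordered chains induced by a map of vertices. -/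
noncomputable def orderedMap (R : Type*) [CommRing R] {E F : Type*} (f : E → F) :
    (List E →₀ R) →ₗ[R] (List F →₀ R) :=
  Finsupp.lmapDomain R R (List.map f)

@[simp] theorem orderedMap_single (f : E → F) (l : List E) (r : R) :
    orderedMap R f (Finsupp.single l r) = Finsupp.single (l.map f) r := by
  simp [orderedMap]

theorem orderedMap_cone (f : E → F) (a : E) (c : List E →₀ R) :
    orderedMap R f (cone R a c) = cone R (f a) (orderedMap R f c) := by
  induction c using Finsupp.induction_linear with
  | zero => simp
  | add f g hf hg => simp [hf, hg]
  | single l r => simp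

theorem orderedMap_orderedBoundary (f : E → F) (c : List E →₀ R) :
    orderedMap R f (orderedBoundary R E c) = orderedBoundary R F (orderedMap R f c) := by
  induction c using Finsupp.induction_linear with
  | zero => simp
  | add f g hf hg => simp [hf, hg]
  | single l r =>
    induction l with
    | nil => simp
    | cons a l ih =>
      rw [orderedBoundary_cons, map_sub, orderedMap_cone, ih]
      simp [orderedBoundary_cons]

theorem orderedMap_orderedMap (g : F → G) (f : E → F) (c : List E →₀ R) :
    orderedMap R g (orderedMap R f c) = orderedMap R (g ∘ f) c := by
  induction c using Finsupp.induction_linear with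
  | zero => simp
  | add f g hf hg => simp [hf, hg]
  | single l r => simp

theorem orderedMap_mem_supported {f : E → F} {P : Set (List E)} {Q : Set (List F)}
    (h : ∀ l ∈ P, l.map f ∈ Q) {c : List E →₀ R} (hc : c ∈ Finsupp.supported R R P) :
    orderedMap R f c ∈ Finsupp.supported R R Q :=
  map_mem_of_mem_supported _ (fun l hl => by
    rw [orderedMap_single]; exact Finsupp.single_mem_supported R _ (h l hl)) hc

theorem orderedMap_eq_self {f : E → E} {P : Set (List E)} (h : ∀ l ∈ P, ∀ x ∈ l, f x = x)
    {c : List E →₀ R} (hc : c ∈ Finsupp.supported R R P) : orderedMap R f c = c := by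
  have := map_mem_of_mem_supported (orderedMap R f - LinearMap.id) (P := P) (Q := ⊥)
    (fun l hl => by
      have : l.map f = l := (List.map_congr_left (g := id) (h l hl)).trans (List.map_id l)
      simp [this]) hc
  simpa [sub_eq_zero] using this

/-- The prism over an ordered simplex, between the images under `f` and `g`. -/
noncomputable def listPrism (R : Type*) [CommRing R] {E F : Type*} (f g : E → F) :
    List E → (List F →₀ R)
  | [] => 0
  | a :: l => Finsupp.single (f a :: g a :: l.map g) 1 - cone R (f a) (listPrism R f g l)

/-- The prism operator, a chain homotopy between the maps induced by `f` and `g`. -/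
noncomputable def prism (R : Type*) [CommRing R] {E F : Type*} (f g : E → F) :
    (List E →₀ R) →ₗ[R] (List F →₀ R) :=
  Finsupp.linearCombination R (listPrism R f g)

theorem prism_cone (f g : E → F) (a : E) (c : List E →₀ R) :
    prism R f g (cone R a c) =
      cone R (f a) (cone R (g a) (orderedMap R g c)) - cone R (f a) (prism R f g c) := by
  induction c using Finsupp.induction_linear with
  | zero => simp
  | add f g hf hg => simp only [map_add, hf, hg]; abel
  | single l r => simp [prism, listPrism, smul_sub]

theorem prism_homotopy (f g : E → F) (c : List E →₀ R) :
    orderedBoundary R F (prism R f g c) + prism R f g (orderedBoundary R E c) =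
      orderedMap R g c - orderedMap R f c := by
  induction c using Finsupp.induction_linear with
  | zero => simp
  | add c d hc hd =>
    simp only [map_add]
    rw [add_add_add_comm, hc, hd]
    abel
  | single l r =>
    induction l with
    | nil => simp [prism, listPrism]
    | cons a l ih =>
      rw [← cone_single, prism_cone, map_sub, orderedBoundary_cone, orderedBoundary_cone,
        orderedBoundary_cone, orderedBoundary_cone, map_sub (prism R f g), prism_cone,
        orderedMap_cone, orderedMap_cone, ← orderedMap_orderedBoundary]
      have := congrArg (cone R (f a)) ih
      simp only [map_add, map_sub] at this ⊢
      rw [← sub_eq_zero] at this ⊢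
      rw [← this]
      abel

theorem prism_mem_supported {f g : E → F} {P : Set (List E)} {Q : Set (List F)}
    (h : ∀ l ∈ P, ∀ m : List F, (∀ y ∈ m, ∃ x ∈ l, y = f x ∨ y = g x) → m ∈ Q)
    {c : List E →₀ R} (hc : c ∈ Finsupp.supported R R P) :
    prism R f g c ∈ Finsupp.supported R R Q := by
  refine map_mem_of_mem_supported _ (fun l hl => ?_) hc
  suffices prism R f g (Finsupp.single l 1) ∈
      Finsupp.supported R R {m | ∀ y ∈ m, ∃ x ∈ l, y = f x ∨ y = g x} from
    Finsupp.supported_mono (fun m hm => h l hl m hm) this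
  clear hl
  induction l with
  | nil => simp [prism, listPrism]
  | cons a l ih =>
    rw [← cone_single, prism_cone, orderedMap_single, cone_single, cone_single]
    refine Submodule.sub_mem _ (Finsupp.single_mem_supported R _ ?_) ?_
    · intro y hy
      simp only [List.mem_cons, List.mem_map] at hy
      rcases hy with rfl | rfl | ⟨x, hx, rfl⟩
      · exact ⟨a, by simp, Or.inl rfl⟩
      · exact ⟨a, by simp, Or.inr rfl⟩
      · exact ⟨x, by simp [hx], Or.inr rfl⟩
    · refine cone_mem_supported (fun m hm y hy => ?_) ih
      rcases List.mem_cons.mp hy with rfl | hy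
      · exact ⟨a, by simp, Or.inl rfl⟩
      · obtain ⟨x, hx, h⟩ := hm y hy
        exact ⟨x, by simp [hx], h⟩

end OrderedChains

/-! ### Barycentric subdivision of affine chains -/

section Subdivision

variable {R : Type*} [CommRing R] {E : Type*}

/-- The sum over omitted entries makes visible that faces are shorter lists; the subdivision
recursion terminates for this reason. -/
theorem orderedBoundary_single_eq_sum (l : List E) :
    orderedBoundary R E (Finsupp.single l 1) =
      ∑ i : Fin l.length, Finsupp.single (l.eraseIdx i) ((-1 : R) ^ (i : ℕ)) := by
  induction l with
  | nil => simp
  | cons a l ih =>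
    rw [orderedBoundary_cons, ih, map_sum]
    simp only [List.length_cons, Fin.sum_univ_succ, cone_single, Fin.val_zero,
      List.eraseIdx_zero, List.tail_cons, pow_zero, Fin.val_succ, List.eraseIdx_cons_succ,
      pow_succ, mul_neg, mul_one, Finsupp.single_neg, Finset.sum_neg_distrib, sub_eq_add_neg]

variable [NormedAddCommGroup E] [NormedSpace ℝ E]

/-- The barycenter of a list of points. -/
noncomputable def barycenter (l : List E) : E := (l.length : ℝ)⁻¹ • l.sum

/-- The chain homotopy from barycentric subdivision to the identity, on a single simplex. -/
noncomputable def listSubdivisionHomotopy (R : Type*) [CommRing R] (l : List E) :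
    List E →₀ R :=
  if l = [] then 0 else
    cone R (barycenter l) (Finsupp.single l 1 -
      ∑ i : Fin l.length, (-1 : R) ^ (i : ℕ) • listSubdivisionHomotopy R (l.eraseIdx i))
termination_by l.length
decreasing_by
  rw [List.length_eraseIdx_of_lt i.2]
  have := i.2
  omega

/-- The chain homotopy from barycentric subdivision to the identity. -/
noncomputable def subdivisionHomotopy (R : Type*) [CommRing R] :
    (List E →₀ R) →ₗ[R] (List E →₀ R) :=
  Finsupp.linearCombination R (listSubdivisionHomotopy R)

theorem subdivisionHomotopy_single {l : List E} (hl : l ≠ []) :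
    subdivisionHomotopy R (Finsupp.single l 1) = cone R (barycenter l)
      (Finsupp.single l 1 -
        subdivisionHomotopy R (orderedBoundary R E (Finsupp.single l 1))) := by
  rw [orderedBoundary_single_eq_sum, map_sum]
  simp only [subdivisionHomotopy, Finsupp.linearCombination_single, one_smul]
  rw [listSubdivisionHomotopy, if_neg hl]

@[simp] theorem subdivisionHomotopy_nil (r : R) :
    subdivisionHomotopy R (Finsupp.single ([] : List E) r) = 0 := by
  simp [subdivisionHomotopy, listSubdivisionHomotopy]

/-- Barycentric subdivision of affine chains. -/
noncomputable def subdivision (R : Type*) [CommRing R] {E : Type*} [NormedAddCommGroup E]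
    [NormedSpace ℝ E] : (List E →₀ R) →ₗ[R] (List E →₀ R) :=
  LinearMap.id - orderedBoundary R E ∘ₗ subdivisionHomotopy R -
    subdivisionHomotopy R ∘ₗ orderedBoundary R E

theorem subdivision_apply (c : List E →₀ R) :
    subdivision R c = c - orderedBoundary R E (subdivisionHomotopy R c) -
      subdivisionHomotopy R (orderedBoundary R E c) := rfl

theorem orderedBoundary_subdivision (c : List E →₀ R) :
    orderedBoundary R E (subdivision R c) = subdivision R (orderedBoundary R E c) := by
  simp [subdivision_apply, orderedBoundary_orderedBoundary]

/-- This is the usual recursion for barycentric subdivision. Defining the operator as `1 - ∂T - T∂`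
makes it a chain map homotopic to the identity for free, and the recursion follows from `T l = b ·
(l - T ∂l)`. -/
theorem subdivision_single {l : List E} (hl : l ≠ []) :
    subdivision R (Finsupp.single l 1) = cone R (barycenter l)
      (subdivision R (orderedBoundary R E (Finsupp.single l 1))) := by
  rw [subdivision_apply, subdivision_apply, subdivisionHomotopy_single hl, orderedBoundary_cone,
    orderedBoundary_orderedBoundary]
  simp only [map_sub, map_zero]
  abel

theorem subdivision_nil :
    subdivision R (Finsupp.single ([] : List E) 1) = Finsupp.single [] 1 := by
  simp [subdivision_apply]

theorem barycenter_mem_convexHull {l : List E} (hl : l ≠ []) :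
    barycenter l ∈ convexHull ℝ {x | x ∈ l} := by
  have hn : (0 : ℝ) < l.length := by exact_mod_cast List.length_pos_of_ne_nil hl
  have : barycenter l = ∑ i : Fin l.length, (l.length : ℝ)⁻¹ • l.get i := by
    rw [barycenter, ← Finset.smul_sum]
    congr 1
    conv_lhs => rw [← List.ofFn_get l, List.sum_ofFn]
  rw [this]
  refine (convex_convexHull ℝ _).sum_mem (fun _ _ => by positivity) ?_
    (fun i _ => subset_convexHull ℝ _ (List.get_mem l i))
  simp [hn.ne']

theorem subdivisionHomotopy_mem_supported (l : List E) :
    subdivisionHomotopy R (Finsupp.single l 1) ∈ Finsupp.supported R R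
      {m | m.length ≤ l.length + 1 ∧ ∀ x ∈ m, x ∈ convexHull ℝ {y | y ∈ l}} := by
  induction h : l.length using Nat.strong_induction_on generalizing l with
  | _ n ih =>
    rcases eq_or_ne l [] with rfl | hl
    · simp
    rw [subdivisionHomotopy_single hl]
    refine cone_mem_supported
      (P := {m | m.length ≤ n ∧ ∀ x ∈ m, x ∈ convexHull ℝ {y | y ∈ l}}) ?_ ?_
    · rintro m ⟨hm, hx⟩
      refine ⟨by simp; omega, fun x hx' => ?_⟩
      rcases List.mem_cons.mp hx' with rfl | hx'
      · exact barycenter_mem_convexHull hl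
      · exact hx x hx'
    · refine Submodule.sub_mem _ (Finsupp.single_mem_supported R _
        ⟨h.le, fun x hx => subset_convexHull ℝ _ hx⟩) ?_
      refine map_mem_of_mem_supported _ (fun m hm => ?_) (orderedBoundary_single_mem_supported l)
      refine Finsupp.supported_mono ?_ (ih m.length (by have := hm.1; omega) m rfl)
      rintro p ⟨hp, hx⟩
      exact ⟨by have := hm.1; omega, fun x hx' => convexHull_mono (fun y hy => hm.2 hy) (hx x hx')⟩

theorem subdivision_mem_supported (l : List E) :
    subdivision R (Finsupp.single l 1) ∈ Finsupp.supported R R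
      {m | m.length ≤ l.length ∧ ∀ x ∈ m, x ∈ convexHull ℝ {y | y ∈ l}} := by
  rw [subdivision_apply]
  refine Submodule.sub_mem _ (Submodule.sub_mem _ (Finsupp.single_mem_supported R _
    ⟨le_rfl, fun x hx => subset_convexHull ℝ _ hx⟩) ?_) ?_
  · refine map_mem_of_mem_supported _ (fun m hm => ?_) (subdivisionHomotopy_mem_supported l)
    refine Finsupp.supported_mono ?_ (orderedBoundary_single_mem_supported m)
    rintro p ⟨hp, hpm⟩
    exact ⟨by have := hm.1; omega, fun x hx => hm.2 x (hpm hx)⟩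
  · refine map_mem_of_mem_supported _ (fun m hm => ?_) (orderedBoundary_single_mem_supported l)
    refine Finsupp.supported_mono ?_ (subdivisionHomotopy_mem_supported m)
    rintro p ⟨hp, hx⟩
    exact ⟨by have := hm.1; omega, fun x hx' => convexHull_mono (fun y hy => hm.2 hy) (hx x hx')⟩

/-- The points of a list have pairwise distance at most `d`. -/
def DistLE (d : ℝ) (l : List E) : Prop := ∀ x ∈ l, ∀ y ∈ l, dist x y ≤ d

theorem DistLE.of_mem_convexHull {d : ℝ} {l m : List E} (hl : DistLE d l)
    (hm : ∀ x ∈ m, x ∈ convexHull ℝ {y | y ∈ l}) : DistLE d m := by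
  intro x hx y hy
  obtain ⟨x', hx', y', hy', h⟩ := convexHull_exists_dist_ge2 (hm x hx) (hm y hy)
  exact h.trans (hl x' hx' y' hy')

theorem dist_barycenter_le {d : ℝ} (hd : 0 ≤ d) {J : ℕ} {l : List E} (hl : DistLE d l)
    (hJ : l.length ≤ J) (hne : l ≠ []) {x : E} (hx : x ∈ convexHull ℝ {y | y ∈ l}) :
    dist x (barycenter l) ≤ (1 - (J : ℝ)⁻¹) * d := by
  have hn : (0 : ℝ) < l.length := by exact_mod_cast List.length_pos_of_ne_nil hne
  suffices convexHull ℝ {y | y ∈ l} ⊆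
      Metric.closedBall (barycenter l) ((1 - (J : ℝ)⁻¹) * d) from this hx
  refine convexHull_min (fun y hy => ?_) (convex_closedBall _ _)
  obtain ⟨k, hk⟩ := List.mem_iff_get.mp hy
  have h1 : y - barycenter l = (l.length : ℝ)⁻¹ • ∑ i : Fin l.length, (y - l.get i) := by
    rw [Finset.sum_sub_distrib, Finset.sum_const, smul_sub, barycenter]
    congr 1
    · rw [Finset.card_univ, Fintype.card_fin, ← Nat.cast_smul_eq_nsmul ℝ, smul_smul,
        inv_mul_cancel₀ hn.ne', one_smul]
    · congr 1
      conv_lhs => rw [← List.ofFn_get l, List.sum_ofFn]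
  -- The term with `l.get i = y` vanishes; the saved summand produces the contraction factor.
  have h2 : ‖∑ i : Fin l.length, (y - l.get i)‖ ≤ (l.length - 1) * d := by
    rw [← Finset.sum_erase Finset.univ (a := k) (by rw [hk, sub_self])]
    refine (norm_sum_le_of_le _ (n := fun _ => d) fun i _ => ?_).trans ?_
    · rw [← dist_eq_norm]
      exact hl y hy _ (List.get_mem l i)
    · rw [Finset.sum_const, Finset.card_erase_of_mem (Finset.mem_univ _), Finset.card_univ,
        Fintype.card_fin, nsmul_eq_mul, Nat.cast_sub (List.length_pos_of_ne_nil hne)]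
      simp
  rw [Metric.mem_closedBall, dist_eq_norm, h1, norm_smul, norm_inv, Real.norm_natCast]
  calc (l.length : ℝ)⁻¹ * ‖∑ i : Fin l.length, (y - l.get i)‖
      ≤ (l.length : ℝ)⁻¹ * ((l.length - 1) * d) := by gcongr
    _ = (1 - (l.length : ℝ)⁻¹) * d := by field_simp
    _ ≤ (1 - (J : ℝ)⁻¹) * d := by gcongr

/-- Two points of a subdivided simplex either both come from the subdivision of a face, where
induction applies, or one of them is the barycenter. The factor depends only on the bound `J`, so it
can be iterated uniformly. -/
theorem subdivision_mem_supported_distLE {d : ℝ} (hd : 0 ≤ d) {J : ℕ} (hJ0 : 0 < J) {l : List E}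
    (hl : DistLE d l) (hJ : l.length ≤ J) :
    subdivision R (Finsupp.single l 1) ∈
      Finsupp.supported R R {m | DistLE ((1 - (J : ℝ)⁻¹) * d) m} := by
  have hθ : 0 ≤ (1 - (J : ℝ)⁻¹) * d :=
    mul_nonneg (sub_nonneg.mpr (inv_le_one_of_one_le₀ (by exact_mod_cast hJ0))) hd
  induction h : l.length using Nat.strong_induction_on generalizing l with
  | _ n ih =>
    rcases eq_or_ne l [] with rfl | hne
    · rw [subdivision_nil]
      exact Finsupp.single_mem_supported R _ (fun x hx => by simp at hx)
    rw [subdivision_single hne]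
    refine cone_mem_supported (P := {m | DistLE ((1 - (J : ℝ)⁻¹) * d) m} ∩
      {m | m.length ≤ l.length ∧ ∀ x ∈ m, x ∈ convexHull ℝ {y | y ∈ l}}) ?_ ?_
    · rintro m ⟨hm, -, hx⟩ x hx' y hy'
      rcases List.mem_cons.mp hx' with rfl | hx' <;> rcases List.mem_cons.mp hy' with rfl | hy'
      · simpa using hθ
      · rw [dist_comm]
        exact dist_barycenter_le hd hl hJ hne (hx y hy')
      · exact dist_barycenter_le hd hl hJ hne (hx x hx')
      · exact hm x hx' y hy'
    · refine map_mem_of_mem_supported _ (fun m hm => ?_) (orderedBoundary_single_mem_supported l)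
      rw [Finsupp.supported_inter]
      refine ⟨ih m.length (by have := hm.1; omega) (fun x hx y hy => hl x (hm.2 hx) y (hm.2 hy))
        (by have := hm.1; omega) rfl, Finsupp.supported_mono ?_ (subdivision_mem_supported m)⟩
      rintro p ⟨hp, hx⟩
      exact ⟨by have := hm.1; omega,
        fun x hx' => convexHull_mono (fun y hy => hm.2 hy) (hx x hx')⟩

/-- Iterated subdivision preserves any support that is closed under passing to lists of points in
the convex hull. -/
theorem subdivision_pow_mem_supported {P : Set (List E)}
    (hP : ∀ l ∈ P, ∀ m : List E, m.length ≤ l.length →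
      (∀ x ∈ m, x ∈ convexHull ℝ {y | y ∈ l}) → m ∈ P)
    {c : List E →₀ R} (hc : c ∈ Finsupp.supported R R P) (N : ℕ) :
    (subdivision R ^ N) c ∈ Finsupp.supported R R P := by
  induction N with
  | zero => simpa using hc
  | succ N ih =>
    rw [pow_succ', Module.End.mul_apply]
    exact map_mem_of_mem_supported _ (fun l hl => Finsupp.supported_mono
      (fun m hm => hP l hl m hm.1 hm.2) (subdivision_mem_supported l)) ih

theorem orderedBoundary_subdivision_pow (c : List E →₀ R) (N : ℕ) :
    orderedBoundary R E ((subdivision R ^ N) c) =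
      (subdivision R ^ N) (orderedBoundary R E c) := by
  induction N with
  | zero => simp
  | succ N ih =>
    rw [pow_succ', Module.End.mul_apply, Module.End.mul_apply, orderedBoundary_subdivision, ih]

theorem exists_subdivision_pow_mem_supported (J : ℕ) {d ε : ℝ} (hd : 0 ≤ d) (hε : 0 < ε) :
    ∃ N : ℕ, ∀ c : List E →₀ R, c ∈ Finsupp.supported R R {l | l.length ≤ J ∧ DistLE d l} →
      (subdivision R ^ N) c ∈ Finsupp.supported R R {l | DistLE ε l} := by
  wlog hJ0 : 0 < J generalizing J
  · obtain ⟨N, hN⟩ := this 1 one_pos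
    refine ⟨N, fun c hc => hN c (Finsupp.supported_mono ?_ hc)⟩
    rintro l ⟨hl, hl'⟩
    exact ⟨by omega, hl'⟩
  have h0 : 0 ≤ 1 - (J : ℝ)⁻¹ :=
    sub_nonneg.mpr (inv_le_one_of_one_le₀ (by exact_mod_cast hJ0))
  have h1 : 1 - (J : ℝ)⁻¹ < 1 := by
    have : (0 : ℝ) < (J : ℝ)⁻¹ := by positivity
    linarith
  -- The denominator `d + 1` covers the case `d = 0`.
  obtain ⟨N, hN⟩ := exists_pow_lt_of_lt_one (show 0 < ε / (d + 1) by positivity) h1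
  have key : ∀ N : ℕ, ∀ c : List E →₀ R,
      c ∈ Finsupp.supported R R {l | l.length ≤ J ∧ DistLE d l} →
      (subdivision R ^ N) c ∈
        Finsupp.supported R R {l | l.length ≤ J ∧ DistLE ((1 - (J : ℝ)⁻¹) ^ N * d) l} := by
    intro N c hc
    induction N with
    | zero => simpa using hc
    | succ N ih =>
      rw [pow_succ' (subdivision R), Module.End.mul_apply]
      refine map_mem_of_mem_supported _ (fun l hl => ?_) ih
      have := And.intro (subdivision_mem_supported (R := R) l)
        (subdivision_mem_supported_distLE (R := R) (by positivity) hJ0 hl.2 hl.1)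
      rw [← Submodule.mem_inf, ← Finsupp.supported_inter] at this
      refine Finsupp.supported_mono ?_ this
      rintro m ⟨hm, hm'⟩
      refine ⟨hm.1.trans hl.1, ?_⟩
      rw [pow_succ', mul_assoc]
      exact hm'
  refine ⟨N, fun c hc => Finsupp.supported_mono ?_ (key N c hc)⟩
  rintro l ⟨-, hl⟩ x hx y hy
  refine (hl x hx y hy).trans ?_
  rw [lt_div_iff₀ (by positivity)] at hN
  have : (1 - (J : ℝ)⁻¹) ^ N * d ≤ (1 - (J : ℝ)⁻¹) ^ N * (d + 1) := by gcongr; linarith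
  linarith

/-- A cycle and its iterated subdivision differ by a boundary with the same support. -/
theorem exists_orderedBoundary_eq_sub_subdivision_pow {P Q : Set (List E)}
    (hP : ∀ l ∈ P, ∀ m : List E, m.length ≤ l.length →
      (∀ x ∈ m, x ∈ convexHull ℝ {y | y ∈ l}) → m ∈ P)
    (hQ : ∀ l ∈ P, ∀ m : List E, (∀ x ∈ m, x ∈ convexHull ℝ {y | y ∈ l}) → m ∈ Q)
    {c : List E →₀ R} (hc : c ∈ Finsupp.supported R R P) (hc0 : orderedBoundary R E c = 0)
    (N : ℕ) : ∃ e ∈ Finsupp.supported R R Q,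
      orderedBoundary R E e = c - (subdivision R ^ N) c := by
  induction N with
  | zero => exact ⟨0, Submodule.zero_mem _, by simp⟩
  | succ N ih =>
    obtain ⟨e, he, h⟩ := ih
    refine ⟨e + subdivisionHomotopy R ((subdivision R ^ N) c), Submodule.add_mem _ he ?_, ?_⟩
    · exact map_mem_of_mem_supported _ (fun l hl => Finsupp.supported_mono
        (fun m hm => hQ l hl m hm.2) (subdivisionHomotopy_mem_supported l))
        (subdivision_pow_mem_supported hP hc N)
    · rw [map_add, h, pow_succ', Module.End.mul_apply, subdivision_apply,
        orderedBoundary_subdivision_pow, hc0]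
      simp only [map_zero]
      abel

end Subdivision

/-! ### Comparison of oriented and ordered chains -/

section Oriented

variable {R : Type*} [CommRing R] {V : Type*} [LinearOrder V]

theorem faceSign_mul_self (s : Finset V) (v : V) : faceSign R s v * faceSign R s v = 1 := by
  rw [faceSign, ← mul_pow]
  simp

/-- The cone with apex `a` over an oriented chain. -/
noncomputable def orientedCone (R : Type*) [CommRing R] {V : Type*} [LinearOrder V] (a : V) :
    (Finset V →₀ R) →ₗ[R] (Finset V →₀ R) :=
  Finsupp.linearCombination R (fun s => if a ∈ s then 0 else
    Finsupp.single (insert a s) (faceSign R (insert a s) a))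

theorem orientedCone_single (a : V) (s : Finset V) (r : R) :
    orientedCone R a (Finsupp.single s r) = if a ∈ s then 0 else
      Finsupp.single (insert a s) (r * faceSign R (insert a s) a) := by
  rw [orientedCone, Finsupp.linearCombination_single]
  split_ifs <;> simp

/-- The oriented cone satisfies the same homotopy identity as the ordered one. If `a` is already a
vertex of `s`, the cone over `s` is zero and only the face opposite `a` contributes to the cone over
the boundary. -/
theorem boundary_orientedCone (a : V) (c : Finset V →₀ R) :
    boundary R V (orientedCone R a c) = c - orientedCone R a (boundary R V c) := by
  induction c using Finsupp.induction_linear with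
  | zero => simp
  | add f g hf hg => simp only [map_add, hf, hg]; abel
  | single s r =>
    rw [boundary_single, map_sum]
    by_cases ha : a ∈ s
    · rw [orientedCone_single, if_pos ha, map_zero, eq_comm, sub_eq_zero, eq_comm,
        Finset.sum_eq_single_of_mem a ha]
      · rw [orientedCone_single, if_neg (Finset.notMem_erase a s), Finset.insert_erase ha,
          mul_assoc, faceSign_mul_self, mul_one]
      · intro v _ hva
        rw [orientedCone_single, if_pos (Finset.mem_erase.mpr ⟨hva.symm, ha⟩)]
    · rw [orientedCone_single, if_neg ha, boundary_single, Finset.sum_insert ha,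
        Finset.erase_insert ha, mul_assoc, faceSign_mul_self, mul_one, sub_eq_add_neg,
        ← Finset.sum_neg_distrib]
      congr 1
      refine Finset.sum_congr rfl fun v hv => ?_
      have hav : a ≠ v := fun h => ha (h ▸ hv)
      rw [orientedCone_single, if_neg (fun h => ha (Finset.mem_of_mem_erase h)),
        ← Finsupp.single_neg, Finset.erase_insert_of_ne hav]
      congr 1
      have h := faceSign_erase (R := R) (Finset.mem_insert_self a s)
        (Finset.mem_insert_of_mem hv) hav
      rw [Finset.erase_insert ha, Finset.erase_insert_of_ne hav] at h
      have h1 := faceSign_mul_self (R := R) (insert a s) a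
      have h2 := faceSign_mul_self (R := R) (insert a (s.erase v)) a
      linear_combination (r * faceSign R (insert a s) a *
        faceSign R (insert a (s.erase v)) a) * h -
        r * faceSign R s v * faceSign R (insert a (s.erase v)) a * h1 -
        r * faceSign R (insert a s) a * faceSign R (insert a s) v * h2

/-- The oriented simplex of an ordered one. -/
noncomputable def listToOriented (R : Type*) [CommRing R] {V : Type*} [LinearOrder V] :
    List V → (Finset V →₀ R)
  | [] => Finsupp.single ∅ 1
  | a :: l => orientedCone R a (listToOriented R l)

/-- The projection from ordered to oriented chains. -/
noncomputable def toOriented (R : Type*) [CommRing R] {V : Type*} [LinearOrder V] :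
    (List V →₀ R) →ₗ[R] (Finset V →₀ R) :=
  Finsupp.linearCombination R (listToOriented R)

theorem toOriented_cone (a : V) (c : List V →₀ R) :
    toOriented R (cone R a c) = orientedCone R a (toOriented R c) := by
  induction c using Finsupp.induction_linear with
  | zero => simp
  | add f g hf hg => simp only [map_add, hf, hg]
  | single l r => simp [toOriented, listToOriented]

theorem boundary_toOriented (c : List V →₀ R) :
    boundary R V (toOriented R c) = toOriented R (orderedBoundary R V c) := by
  induction c using Finsupp.induction_linear with
  | zero => simp
  | add f g hf hg => simp only [map_add, hf, hg]
  | single l r =>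
    induction l with
    | nil => simp [toOriented, listToOriented, boundary_single]
    | cons a l ih =>
      rw [← cone_single, toOriented_cone, boundary_orientedCone, ih, orderedBoundary_cone,
        map_sub, toOriented_cone]

theorem toOriented_single_mem_supported (l : List V) :
    toOriented R (Finsupp.single l 1) ∈ Finsupp.supported R R {s | s ⊆ l.toFinset} := by
  induction l with
  | nil =>
    rw [toOriented, Finsupp.linearCombination_single, one_smul]
    exact Finsupp.single_mem_supported R _ (by simp)
  | cons a l ih =>
    rw [← cone_single, toOriented_cone]
    refine map_mem_of_mem_supported _ (fun s hs => ?_) ih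
    rw [orientedCone_single]
    split_ifs
    · exact Submodule.zero_mem _
    · refine Finsupp.single_mem_supported R _ ?_
      simp only [List.toFinset_cons, Set.mem_ofPred_eq]
      exact Finset.insert_subset_insert a hs

/-- The inclusion of oriented into ordered chains, which sorts the vertices. -/
noncomputable def ofOriented (R : Type*) [CommRing R] {V : Type*} [LinearOrder V] :
    (Finset V →₀ R) →ₗ[R] (List V →₀ R) :=
  Finsupp.lmapDomain R R (fun s => s.sort (· ≤ ·))

@[simp] theorem ofOriented_single (s : Finset V) (r : R) :
    ofOriented R (Finsupp.single s r) = Finsupp.single (s.sort (· ≤ ·)) r := by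
  simp [ofOriented]

theorem orientedCone_single_of_lt {a : V} {s : Finset V} (h : ∀ x ∈ s, a < x) (r : R) :
    orientedCone R a (Finsupp.single s r) = Finsupp.single (insert a s) r := by
  rw [orientedCone_single, if_neg (fun ha => (h a ha).false), faceSign, Finset.filter_false_of_mem]
  · simp
  · intro x hx
    rcases Finset.mem_insert.mp hx with rfl | hx
    · exact lt_irrefl _
    · exact (h x hx).not_gt

theorem sort_insert_of_lt {a : V} {s : Finset V} (h : ∀ x ∈ s, a < x) :
    (insert a s).sort (· ≤ ·) = a :: s.sort (· ≤ ·) :=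
  Finset.sort_insert (· ≤ ·) (fun x hx => (h x hx).le) (fun ha => (h a ha).false)

theorem toOriented_ofOriented (c : Finset V →₀ R) : toOriented R (ofOriented R c) = c := by
  induction c using Finsupp.induction_linear with
  | zero => simp
  | add f g hf hg => simp only [map_add, hf, hg]
  | single s r =>
    induction s using Finset.induction_on_min with
    | empty => simp [toOriented, listToOriented]
    | insert a s h ih =>
      rw [ofOriented_single, sort_insert_of_lt h, ← cone_single, toOriented_cone,
        ← ofOriented_single, ih, orientedCone_single_of_lt h]

theorem ofOriented_orientedCone {a : V} {c : Finset V →₀ R}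
    (hc : c ∈ Finsupp.supported R R {s | ∀ x ∈ s, a < x}) :
    ofOriented R (orientedCone R a c) = cone R a (ofOriented R c) := by
  have := map_mem_of_mem_supported (Q := ⊥)
    (ofOriented R ∘ₗ orientedCone R a - cone R a ∘ₗ ofOriented R) (fun s hs => by
      simp [orientedCone_single_of_lt hs, sort_insert_of_lt hs]) hc
  simpa [sub_eq_zero] using this

theorem boundary_single_mem_supported (s : Finset V) (r : R) :
    boundary R V (Finsupp.single s r) ∈
      Finsupp.supported R R {t | t ⊆ s ∧ t.card + 1 = s.card} := by
  rw [boundary_single]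
  exact Submodule.sum_mem _ fun v hv => Finsupp.single_mem_supported R _
    ⟨Finset.erase_subset _ _, Finset.card_erase_add_one hv⟩

/-- Induction adds a new smallest vertex, for which the oriented cone carries no sign and sorting
merely prepends the vertex. -/
theorem orderedBoundary_ofOriented (c : Finset V →₀ R) :
    orderedBoundary R V (ofOriented R c) = ofOriented R (boundary R V c) := by
  induction c using Finsupp.induction_linear with
  | zero => simp
  | add f g hf hg => simp only [map_add, hf, hg]
  | single s r =>
    induction s using Finset.induction_on_min with
    | empty => simp [boundary_single]
    | insert a s h ih =>
      rw [ofOriented_single, sort_insert_of_lt h, ← cone_single, orderedBoundary_cone,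
        ← ofOriented_single, ih, ← orientedCone_single_of_lt h, boundary_orientedCone, map_sub,
        ofOriented_orientedCone]
      refine Finsupp.supported_mono ?_ (boundary_single_mem_supported s r)
      rintro t ⟨ht, -⟩ x hx
      exact h x (ht hx)

/-- The boundary lowers cardinality by exactly one, so it respects homogeneous components. This
allows fillings to be built without control of their exact degrees. -/
theorem filter_boundary (j : ℕ) (c : Finset V →₀ R) :
    boundary R V (c.filter (fun s => s.card = j + 1)) =
      (boundary R V c).filter (fun s => s.card = j) := by
  induction c using Finsupp.induction_linear with
  | zero => simp [Finsupp.filter_zero]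
  | add f g hf hg => simp only [Finsupp.filter_add, map_add, hf, hg]
  | single s r =>
    have hs := boundary_single_mem_supported s r
    rw [Finsupp.mem_supported'] at hs
    ext t
    rw [Finsupp.filter_apply]
    by_cases h : s.card = j + 1
    · rw [Finsupp.filter_single_of_pos (fun s : Finset V => s.card = j + 1) h]
      split_ifs with ht
      · rfl
      · exact hs t fun h' => ht (by have := h'.2; omega)
    · rw [Finsupp.filter_single_of_neg (fun s : Finset V => s.card = j + 1) h, map_zero]
      split_ifs with ht
      · exact (hs t fun h' => h (by have := h'.2; omega)).symm
      · rfl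

/-- A homogeneous chain which bounds some chain of the complex bounds a homogeneous one. -/
theorem mem_boundaries_of_boundary_eq {L : PreAbstractSimplicialComplex V} {j : ℕ}
    {z w : Finset V →₀ R} (hz : z ∈ chains R L j)
    (hw : w ∈ Finsupp.supported R R {s | s = ∅ ∨ s ∈ L.faces}) (h : boundary R V w = z) :
    z ∈ boundaries R L j := by
  refine ⟨w.filter (fun s => s.card = j + 1), ?_, ?_⟩
  · rw [chains, SetLike.mem_coe, Finsupp.mem_supported]
    intro s hs
    rw [Finsupp.support_filter, Finset.coe_filter] at hs
    exact ⟨hs.2, hw hs.1⟩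
  · rw [filter_boundary, h, Finsupp.filter_eq_self_iff]
    intro s hs
    exact (hz (Finsupp.mem_support_iff.mpr hs)).1

end Oriented

/-! ### Chains in the underlying space -/

section Geometry

variable {V : Type*} [Fintype V]

/-- The closed geometric simplex spanned by `s`. -/
def closedSimplex (s : Finset V) : Set (V → ℝ) :=
  {x | x ∈ stdSimplex ℝ V ∧ ∀ v, x v ≠ 0 → v ∈ s}

theorem convex_closedSimplex (s : Finset V) : Convex ℝ (closedSimplex s) := by
  intro x hx y hy a b ha hb hab
  refine ⟨convex_stdSimplex ℝ V hx.1 hy.1 ha hb hab, fun v hv => ?_⟩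
  by_contra hvs
  have h1 : x v = 0 := by_contra fun h => hvs (hx.2 v h)
  have h2 : y v = 0 := by_contra fun h => hvs (hy.2 v h)
  simp [h1, h2] at hv

theorem closedSimplex_subset_underlyingSpace {K : AbstractSimplicialComplex V} {s : Finset V}
    (hs : s = ∅ ∨ s ∈ K.faces) : closedSimplex s ⊆ underlyingSpace K := by
  rintro x ⟨hx, h⟩
  rcases hs with rfl | hs
  · have h0 : ∑ v, x v = 0 := Finset.sum_eq_zero fun v _ => by
      by_contra hv
      simpa using h v hv
    rw [hx.2] at h0
    exact absurd h0 one_ne_zero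
  · exact ⟨hx, s, hs, h⟩

theorem isClosed_closedSimplex (s : Finset V) : IsClosed (closedSimplex s) := by
  have : closedSimplex s = stdSimplex ℝ V ∩ ⋂ v ∈ {v | v ∉ s}, {x : V → ℝ | x v = 0} := by
    ext x
    simp only [closedSimplex, Set.mem_inter_iff, Set.mem_iInter, Set.mem_ofPred_eq]
    refine and_congr_right fun _ => forall_congr' fun v => ?_
    tauto
  rw [this]
  exact (isClosed_stdSimplex ℝ V).inter (isClosed_biInter fun v _ =>
    isClosed_eq (continuous_apply v) continuous_const)

theorem isCompact_underlyingSpace (K : AbstractSimplicialComplex V) :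
    IsCompact (underlyingSpace K) := by
  have : underlyingSpace K = ⋃ s ∈ K.faces, closedSimplex s := by
    ext x
    simp only [underlyingSpace, closedSimplex, Set.mem_iUnion, Set.mem_ofPred_eq, exists_prop]
    tauto
  rw [this]
  exact (Set.toFinite _).isCompact_biUnion fun s _ =>
    (isCompact_stdSimplex ℝ V).of_isClosed_subset (isClosed_closedSimplex s) fun _ hx => hx.1

theorem distLE_of_mem_stdSimplex {l : List (V → ℝ)} (h : ∀ x ∈ l, x ∈ stdSimplex ℝ V) :
    DistLE 1 l := by
  intro x hx y hy
  refine (dist_pi_le_iff zero_le_one).mpr fun v => ?_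
  have hx1 := (h x hx).1 v
  have hy1 := (h y hy).1 v
  have hx2 : x v ≤ 1 := (h x hx).2 ▸ Finset.single_le_sum (fun w _ => (h x hx).1 w)
    (Finset.mem_univ v)
  have hy2 : y v ≤ 1 := (h y hy).2 ▸ Finset.single_le_sum (fun w _ => (h y hy).1 w)
    (Finset.mem_univ v)
  rw [Real.dist_eq, abs_le]
  constructor <;> linarith

/-- A continuous map between underlying spaces extends to the ambient spaces with a modulus of
continuity. -/
theorem exists_extension {W : Type*} [Fintype W] {K : AbstractSimplicialComplex V}
    {L : AbstractSimplicialComplex W} {φ : underlyingSpace K → underlyingSpace L}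
    (hφ : Continuous φ) : ∃ f : (V → ℝ) → (W → ℝ), (∀ x : underlyingSpace K, f x = φ x) ∧
      ∀ ε : ℝ, 0 < ε → ∃ δ : ℝ, 0 < δ ∧ ∀ x ∈ underlyingSpace K, ∀ y ∈ underlyingSpace K,
        dist x y ≤ δ → dist (f x) (f y) ≤ ε := by
  classical
  obtain ⟨f, hf⟩ : ∃ f : (V → ℝ) → (W → ℝ), ∀ x : underlyingSpace K, f x = φ x :=
    ⟨fun x => if hx : x ∈ underlyingSpace K then φ ⟨x, hx⟩ else 0, by
      rintro ⟨x, hx⟩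
      simp [hx]⟩
  refine ⟨f, hf, fun ε hε => ?_⟩
  have : CompactSpace (underlyingSpace K) :=
    isCompact_iff_compactSpace.mp (isCompact_underlyingSpace K)
  obtain ⟨δ, hδ, h⟩ := Metric.uniformContinuous_iff.mp
    (CompactSpace.uniformContinuous_of_continuous hφ) ε hε
  refine ⟨δ / 2, half_pos hδ, fun x hx y hy hxy => ?_⟩
  rw [hf ⟨x, hx⟩, hf ⟨y, hy⟩]
  exact (h (a := ⟨x, hx⟩) (b := ⟨y, hy⟩) (by
    rw [Subtype.dist_eq]; exact hxy.trans_lt (half_lt_self hδ))).le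

/-- Nearby points have large coordinates only at the vertices of a common simplex. -/
theorem exists_face_of_distLE {K : AbstractSimplicialComplex V} {δ : ℝ} {l : List (V → ℝ)}
    (hl : ∀ x ∈ l, x ∈ underlyingSpace K) (hd : DistLE δ l) :
    ∃ s : Finset V, (s = ∅ ∨ s ∈ K.faces) ∧ ∀ x ∈ l, ∀ v, δ < x v → v ∈ s := by
  cases l with
  | nil => exact ⟨∅, Or.inl rfl, by simp⟩
  | cons y l =>
    obtain ⟨-, s, hs, h⟩ := hl y (by simp)
    refine ⟨s, Or.inr hs, fun x hx v hv => h v fun hy => ?_⟩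
    have := (dist_le_pi_dist x y v).trans (hd x hx y (by simp))
    rw [hy, Real.dist_eq, sub_zero] at this
    exact absurd (this.trans_lt hv) (not_lt.mpr (le_abs_self _))

omit [Fintype V] in
theorem face_of_subset {K : AbstractSimplicialComplex V} {s t : Finset V}
    (hs : s = ∅ ∨ s ∈ K.faces) (h : t ⊆ s) : t = ∅ ∨ t ∈ K.faces := by
  rcases t.eq_empty_or_nonempty with ht | ht
  · exact Or.inl ht
  rcases hs with rfl | hs
  · exact Or.inl (Finset.subset_empty.mp h)
  · exact Or.inr ((K.isRelLowerSet_faces hs).2 h ht)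

/-! ### Maximal coordinates and truncation -/

variable [Nonempty V]

/-- A vertex at which a barycentric coordinate is maximal. -/
noncomputable def topVertex (x : V → ℝ) : V := (Finite.exists_max x).choose

theorem le_topVertex (x : V → ℝ) (v : V) : x v ≤ x (topVertex x) :=
  (Finite.exists_max x).choose_spec v

theorem inv_card_le_topVertex {x : V → ℝ} (hx : x ∈ stdSimplex ℝ V) :
    (Fintype.card V : ℝ)⁻¹ ≤ x (topVertex x) := by
  have h := Finset.sum_le_sum fun v (_ : v ∈ Finset.univ) => le_topVertex x v
  rw [hx.2, Finset.sum_const, Finset.card_univ, nsmul_eq_mul] at h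
  rw [inv_le_iff_one_le_mul₀ (by exact_mod_cast Fintype.card_pos)]
  linarith

theorem topVertex_mem {x : V → ℝ} {s : Finset V} (hx : x ∈ closedSimplex s) :
    topVertex x ∈ s := by
  refine hx.2 _ (ne_of_gt (lt_of_lt_of_le ?_ (inv_card_le_topVertex hx.1)))
  exact inv_pos.mpr (by exact_mod_cast Fintype.card_pos)

/-- The truncation of a point at height `η`: coordinates up to `η` become zero and their sum is
added to the largest coordinate. -/
noncomputable def truncate [DecidableEq V] (η : ℝ) (x : V → ℝ) : V → ℝ := fun v =>
  (if η < x v then x v else 0) +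
    if v = topVertex x then ∑ w, if η < x w then 0 else x w else 0

variable [DecidableEq V]

/-- The mass removed from small coordinates goes to a maximal one, which is at least `1 / card V >
η`; thus no new vertex enters the support. -/
theorem truncate_mem_closedSimplex {η : ℝ} {x : V → ℝ} (hx : x ∈ stdSimplex ℝ V)
    (hη : η < (Fintype.card V : ℝ)⁻¹) {s : Finset V} (hs : ∀ v, η < x v → v ∈ s) :
    truncate η x ∈ closedSimplex s := by
  have h0 : ∀ w, 0 ≤ x w := hx.1
  refine ⟨⟨fun v => ?_, ?_⟩, fun v hv => ?_⟩
  · refine add_nonneg ?_ ?_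
    · split_ifs
      exacts [h0 v, le_rfl]
    · split_ifs
      · refine Finset.sum_nonneg fun w _ => ?_
        split_ifs
        exacts [le_rfl, h0 w]
      · exact le_rfl
  · simp only [truncate, Finset.sum_add_distrib, Finset.sum_ite_eq', Finset.mem_univ, if_true]
    rw [← Finset.sum_add_distrib, ← hx.2]
    refine Finset.sum_congr rfl fun w _ => ?_
    split_ifs <;> simp
  · by_contra hvs
    have h1 : ¬ η < x v := fun h => hvs (hs v h)
    have h2 : v ≠ topVertex x := by
      rintro rfl
      exact h1 (hη.trans_le (inv_card_le_topVertex hx))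
    simp [truncate, h1, h2] at hv

theorem dist_truncate_le {η : ℝ} (hη0 : 0 ≤ η) {x : V → ℝ} (hx : x ∈ stdSimplex ℝ V)
    (hη : η < (Fintype.card V : ℝ)⁻¹) :
    dist x (truncate η x) ≤ Fintype.card V * η := by
  have h0 : ∀ w, 0 ≤ x w := hx.1
  have hn : (1 : ℝ) ≤ Fintype.card V := by exact_mod_cast Fintype.card_pos
  have hsum0 : 0 ≤ ∑ w, if η < x w then 0 else x w := by
    refine Finset.sum_nonneg fun w _ => ?_
    split_ifs
    exacts [le_rfl, h0 w]
  have hsum1 : (∑ w, if η < x w then 0 else x w) ≤ Fintype.card V * η := by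
    rw [← nsmul_eq_mul, ← Finset.card_univ]
    refine Finset.sum_le_card_nsmul _ _ _ fun w _ => ?_
    split_ifs with h
    exacts [hη0, not_lt.mp h]
  refine (dist_pi_le_iff (by positivity)).mpr fun v => ?_
  rw [Real.dist_eq, truncate]
  by_cases hv : v = topVertex x
  · rw [if_pos hv, if_pos (hv ▸ hη.trans_le (inv_card_le_topVertex hx)), abs_le]
    constructor <;> linarith
  · rw [if_neg hv]
    split_ifs with h
    · simp only [add_zero, sub_self, abs_zero]; positivity
    · rw [add_zero, sub_zero, abs_of_nonneg (h0 v)]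
      nlinarith [not_lt.mp h]

/-- A maximal coordinate exceeds `δ`, so the chosen vertices all lie in the common face of
`exists_face_of_distLE`: the vertex map is simplicial on small lists. -/
theorem toFinset_map_topVertex {K : AbstractSimplicialComplex V} {δ : ℝ} {l : List (V → ℝ)}
    (hl : ∀ x ∈ l, x ∈ underlyingSpace K) (hd : DistLE δ l)
    (hδ : δ < (Fintype.card V : ℝ)⁻¹) :
    (l.map topVertex).toFinset = ∅ ∨ (l.map topVertex).toFinset ∈ K.faces := by
  obtain ⟨s, hs, h⟩ := exists_face_of_distLE hl hd
  refine face_of_subset hs fun v hv => ?_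
  simp only [List.mem_toFinset, List.mem_map] at hv
  obtain ⟨x, hx, rfl⟩ := hv
  exact h x hx _ (hδ.trans_le (inv_card_le_topVertex (hl x hx).1))

/-- The point of the underlying space at a vertex. -/
def vertexPoint (v : V) : V → ℝ := Pi.single v 1

omit [Nonempty V] in
theorem vertexPoint_mem_closedSimplex {v : V} {s : Finset V} (hv : v ∈ s) :
    vertexPoint v ∈ closedSimplex s := by
  refine ⟨single_mem_stdSimplex ℝ v, fun w hw => ?_⟩
  by_contra h
  exact hw (by rw [vertexPoint, Pi.single_eq_of_ne]; rintro rfl; exact h hv)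

theorem topVertex_vertexPoint (v : V) : topVertex (vertexPoint v) = v := by
  simpa using topVertex_mem (vertexPoint_mem_closedSimplex (Finset.mem_singleton_self v))

end Geometry

/-! ### Small chains, affine chains and simplicial approximation -/

section Comparison

variable {R : Type*} [CommRing R] {V W : Type*} [Fintype V] [Fintype W]

/-- The ordered affine simplices that lie in some closed simplex of `K`. -/
def affineSimplices (K : AbstractSimplicialComplex V) : Set (List (V → ℝ)) :=
  {l | ∃ s : Finset V, (s = ∅ ∨ s ∈ K.faces) ∧ ∀ x ∈ l, x ∈ closedSimplex s}

/-- The lists of points of the underlying space with pairwise distance at most `δ`. -/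
def smallSimplices (K : AbstractSimplicialComplex V) (δ : ℝ) : Set (List (V → ℝ)) :=
  {l | (∀ x ∈ l, x ∈ underlyingSpace K) ∧ DistLE δ l}

theorem affineSimplices_of_mem_convexHull {K : AbstractSimplicialComplex V}
    {l m : List (V → ℝ)} (hl : l ∈ affineSimplices K)
    (hm : ∀ x ∈ m, x ∈ convexHull ℝ {y | y ∈ l}) : m ∈ affineSimplices K := by
  obtain ⟨s, hs, h⟩ := hl
  exact ⟨s, hs, fun x hx => convexHull_min h (convex_closedSimplex s) (hm x hx)⟩

theorem mem_underlyingSpace_of_mem_affineSimplices {K : AbstractSimplicialComplex V}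
    {l : List (V → ℝ)} (hl : l ∈ affineSimplices K) : ∀ x ∈ l, x ∈ underlyingSpace K := by
  obtain ⟨s, hs, h⟩ := hl
  exact fun x hx => closedSimplex_subset_underlyingSpace hs (h x hx)

omit [Fintype V] in
theorem exists_length_le (c : List V →₀ R) : ∃ J : ℕ, ∀ l ∈ c.support, l.length ≤ J :=
  ⟨c.support.sup List.length, fun _ hl => Finset.le_sup (f := List.length) hl⟩

/-- A power of the subdivision operator maps affine chains of bounded dimension to small
affine chains. -/
theorem exists_subdivision_pow_small (K : AbstractSimplicialComplex V) (J : ℕ) {ε : ℝ}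
    (hε : 0 < ε) : ∃ N : ℕ, ∀ c : List (V → ℝ) →₀ R,
      c ∈ Finsupp.supported R R ({l | l.length ≤ J} ∩ affineSimplices K) →
      (subdivision R ^ N) c ∈ Finsupp.supported R R
        ({l | l.length ≤ J} ∩ (affineSimplices K ∩ smallSimplices K ε)) := by
  obtain ⟨N, hN⟩ := exists_subdivision_pow_mem_supported (R := R) (E := V → ℝ) J zero_le_one hε
  refine ⟨N, fun c hc => ?_⟩
  have h1 := subdivision_pow_mem_supported
    (P := {l | l.length ≤ J} ∩ affineSimplices K) (fun l hl m hm hm' =>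
      ⟨hm.trans hl.1, affineSimplices_of_mem_convexHull hl.2 hm'⟩) hc N
  have h2 := hN c (by
    refine Finsupp.supported_mono ?_ hc
    rintro l ⟨hl, hl'⟩
    exact ⟨hl, distLE_of_mem_stdSimplex fun x hx =>
      (mem_underlyingSpace_of_mem_affineSimplices hl' x hx).1⟩)
  have h3 := And.intro h1 h2
  rw [← Submodule.mem_inf, ← Finsupp.supported_inter] at h3
  refine Finsupp.supported_mono ?_ h3
  rintro l ⟨⟨hl, hl'⟩, hd⟩
  exact ⟨hl, hl', mem_underlyingSpace_of_mem_affineSimplices hl', hd⟩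

/-- A small cycle whose image under the vertex map vanishes bounds a chain which is as small as
required. -/
theorem exists_orderedBoundary_eq_of_topVertex_eq_zero [Nonempty V]
    (K : AbstractSimplicialComplex V) {ε : ℝ} (hε : 0 < ε) : ∃ δ : ℝ, 0 < δ ∧
      ∀ c ∈ Finsupp.supported R R (smallSimplices K δ), orderedBoundary R _ c = 0 →
        orderedMap R topVertex c = 0 →
        ∃ d ∈ Finsupp.supported R R (smallSimplices K ε), orderedBoundary R _ d = c := by
  classical
  set n : ℝ := (Fintype.card V : ℝ) with hn
  have hn1 : 1 ≤ n := by rw [hn]; exact_mod_cast Fintype.card_pos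
  -- The bound `η < n⁻¹` keeps maximal coordinates through truncation, and `n * η ≤ ε / 4` limits
  -- how far truncation moves a point.
  obtain ⟨η, hη0, hη1, hη2⟩ : ∃ η : ℝ, 0 < η ∧ η < n⁻¹ ∧ n * η ≤ ε / 4 := by
    refine ⟨min (1 / (2 * n)) (ε / (4 * n)), by positivity, ?_, ?_⟩
    · refine (min_le_left _ _).trans_lt ?_
      rw [one_div, mul_inv]
      have : 0 < n⁻¹ := by positivity
      linarith
    · calc n * min (1 / (2 * n)) (ε / (4 * n)) ≤ n * (ε / (4 * n)) := by gcongr; exact min_le_right _ _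
        _ = ε / 4 := by field_simp
  refine ⟨min η (ε / 4), by positivity, fun c hc hc0 htop => ?_⟩
  set δ := min η (ε / 4)
  have htrunc : ∀ x ∈ underlyingSpace K, dist x (truncate η x) ≤ ε / 4 := fun x hx =>
    (dist_truncate_le hη0.le hx.1 hη1).trans hη2
  -- the truncated chain is affine
  have haff : ∀ l ∈ smallSimplices K δ, ∃ s : Finset V, (s = ∅ ∨ s ∈ K.faces) ∧
      ∀ x ∈ l, truncate η x ∈ closedSimplex s ∧ vertexPoint (topVertex x) ∈ closedSimplex s := by
    rintro l ⟨hl, hd⟩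
    obtain ⟨s, hs, h⟩ := exists_face_of_distLE hl hd
    have h' : ∀ x ∈ l, ∀ v, η < x v → v ∈ s := fun x hx v hv =>
      h x hx v ((min_le_left _ _).trans_lt hv)
    exact ⟨s, hs, fun x hx => ⟨truncate_mem_closedSimplex (hl x hx).1 hη1 (h' x hx),
      vertexPoint_mem_closedSimplex (h' x hx _
        (hη1.trans_le (inv_card_le_topVertex (hl x hx).1)))⟩⟩
  set c' := orderedMap R (truncate η) c with hc'
  have hc'0 : orderedBoundary R _ c' = 0 := by
    rw [hc', ← orderedMap_orderedBoundary, hc0, map_zero]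
  have hsmall : ∀ l ∈ smallSimplices K δ, ∀ m : List (V → ℝ),
      (∀ y ∈ m, ∃ x ∈ l, y = truncate η x ∨ y = id x) → m ∈ smallSimplices K ε := by
    intro l hl m hm
    obtain ⟨s, hs, h⟩ := haff l hl
    refine ⟨fun y hy => ?_, fun y hy z hz => ?_⟩
    · obtain ⟨x, hx, rfl | rfl⟩ := hm y hy
      · exact closedSimplex_subset_underlyingSpace hs (h x hx).1
      · exact hl.1 _ hx
    · have key : ∀ y ∈ m, ∃ x ∈ l, dist y x ≤ ε / 4 := by
        intro y hy
        obtain ⟨x, hx, rfl | rfl⟩ := hm y hy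
        · exact ⟨x, hx, by rw [dist_comm]; exact htrunc x (hl.1 x hx)⟩
        · exact ⟨_, hx, (dist_self _).le.trans (by positivity)⟩
      obtain ⟨x, hx, h1⟩ := key y hy
      obtain ⟨x', hx', h2⟩ := key z hz
      have h3 : dist x x' ≤ ε / 4 := (hl.2 x hx x' hx').trans (min_le_right _ _)
      rw [dist_comm] at h2
      linarith [dist_triangle4 y x x' z]
  have hc'supp : c' ∈ Finsupp.supported R R (affineSimplices K ∩ smallSimplices K ε) := by
    refine orderedMap_mem_supported ?_ hc
    intro l hl
    refine ⟨?_, ?_⟩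
    · obtain ⟨s, hs, h⟩ := haff l hl
      exact ⟨s, hs, by simpa using fun x hx => (h x hx).1⟩
    · refine hsmall l hl _ fun y hy => ?_
      obtain ⟨x, hx, rfl⟩ := List.mem_map.mp hy
      exact ⟨x, hx, Or.inl rfl⟩
  -- it bounds an affine chain
  set p := prism R (vertexPoint ∘ topVertex) (truncate η) c
  have hp1 : orderedBoundary R _ p = c' := by
    have := prism_homotopy (R := R) (vertexPoint ∘ topVertex) (truncate η) c
    rwa [hc0, map_zero, add_zero, ← orderedMap_orderedMap, htop, map_zero, sub_zero] at this
  -- The prism `p` is affine but not small, as truncated points may be far from their vertices. It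
  -- must be subdivided, and the number of subdivisions may depend on `p`.
  obtain ⟨J, hJ⟩ := exists_length_le p
  have hp2 : p ∈ Finsupp.supported R R ({l | l.length ≤ J} ∩ affineSimplices K) := by
    rw [Finsupp.supported_inter]
    refine ⟨hJ, prism_mem_supported (fun l hl m hm => ?_) hc⟩
    obtain ⟨s, hs, h⟩ := haff l hl
    refine ⟨s, hs, fun y hy => ?_⟩
    obtain ⟨x, hx, rfl | rfl⟩ := hm y hy
    exacts [(h x hx).2, (h x hx).1]
  obtain ⟨N, hN⟩ := exists_subdivision_pow_small (R := R) K J hε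
  obtain ⟨e, he, he'⟩ := exists_orderedBoundary_eq_sub_subdivision_pow (R := R)
    (P := affineSimplices K ∩ smallSimplices K ε) (Q := smallSimplices K ε)
    (fun l hl m _ hm => ⟨affineSimplices_of_mem_convexHull hl.1 hm,
      mem_underlyingSpace_of_mem_affineSimplices (affineSimplices_of_mem_convexHull hl.1 hm),
      hl.2.2.of_mem_convexHull hm⟩)
    (fun l hl m hm =>
      ⟨mem_underlyingSpace_of_mem_affineSimplices (affineSimplices_of_mem_convexHull hl.1 hm),
      hl.2.2.of_mem_convexHull hm⟩) hc'supp hc'0 N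
  -- The three boundaries are `S^N c'`, `c' - S^N c'` and `c - c'`, where `S` is subdivision; they
  -- add up to `c`.
  refine ⟨(subdivision R ^ N) p + e + prism R (truncate η) id c,
    Submodule.add_mem _ (Submodule.add_mem _ ?_ he) (prism_mem_supported hsmall hc), ?_⟩
  · exact Finsupp.supported_mono (fun l hl => hl.2.2) (hN p hp2)
  · have h1 := prism_homotopy (R := R) (truncate η) id c
    rw [hc0, map_zero, add_zero, orderedMap_eq_self (f := id) (P := Set.univ)
      (fun _ _ _ _ => rfl) (by simp)] at h1
    rw [map_add, map_add, h1, he', orderedBoundary_subdivision_pow, hp1]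
    abel

/-- Cycles modulo boundaries of `K` embed, as cycles modulo a submodule, in the ordered chains of
any complex with a homeomorphic underlying space. -/
theorem exists_linearMap_ker_le_boundaries [LinearOrder V] [Nonempty V] [Nonempty W]
    (K : AbstractSimplicialComplex V) (L : AbstractSimplicialComplex W)
    (h : underlyingSpace K ≃ₜ underlyingSpace L) (j : ℕ) :
    ∃ F : (Finset V →₀ R) →ₗ[R] (List W →₀ R),
      (∀ z ∈ cycles R K.toPreAbstractSimplicialComplex j,
        F z ∈ Finsupp.supported R R {l | l.length ≤ j}) ∧
      ∀ z ∈ cycles R K.toPreAbstractSimplicialComplex j, F z = 0 →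
        z ∈ boundaries R K.toPreAbstractSimplicialComplex j := by
  obtain ⟨f, hf, hfc⟩ := exists_extension h.continuous
  obtain ⟨g, hg, hgc⟩ := exists_extension h.symm.continuous
  have hfm : ∀ x ∈ underlyingSpace K, f x ∈ underlyingSpace L := fun x hx =>
    (hf ⟨x, hx⟩) ▸ (h ⟨x, hx⟩).2
  have hgm : ∀ x ∈ underlyingSpace L, g x ∈ underlyingSpace K := fun x hx =>
    (hg ⟨x, hx⟩) ▸ (h.symm ⟨x, hx⟩).2
  have hgf : ∀ x ∈ underlyingSpace K, g (f x) = x := fun x hx => by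
    rw [hf ⟨x, hx⟩, hg, h.symm_apply_apply]
  have hn : (0 : ℝ) < (Fintype.card V : ℝ)⁻¹ :=
    inv_pos.mpr (by exact_mod_cast Fintype.card_pos)
  -- The constants are chosen backwards: `ε` so that `g` returns lists small enough for the vertex
  -- map of `K`, `δ` from the filling lemma in `L`, `δ'` from the continuity of `f`. Then `N`
  -- depends on `j` but not on the cycle, so that the construction is linear.
  obtain ⟨ε, hε, hgε⟩ := hgc _ (half_pos hn)
  obtain ⟨δ, hδ, hcδ⟩ := exists_orderedBoundary_eq_of_topVertex_eq_zero (R := R) L hε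
  obtain ⟨δ', hδ', hfδ⟩ := hfc δ hδ
  obtain ⟨N, hN⟩ := exists_subdivision_pow_small (R := R) K j hδ'
  set faces' : Set (Finset V) := {s | s = ∅ ∨ s ∈ K.faces}
  set c1 : (Finset V →₀ R) →ₗ[R] _ := orderedMap R (vertexPoint (V := V)) ∘ₗ ofOriented R
  set c2 : (Finset V →₀ R) →ₗ[R] _ := (subdivision R ^ N) ∘ₗ c1
  set c3 : (Finset V →₀ R) →ₗ[R] _ := orderedMap R f ∘ₗ c2
  have hc1 : ∀ z ∈ cycles R K.toPreAbstractSimplicialComplex j,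
      c1 z ∈ Finsupp.supported R R ({l | l.length ≤ j} ∩ affineSimplices K) := by
    rintro z ⟨hz, -⟩
    refine map_mem_of_mem_supported c1 (fun s hs => ?_) hz
    simp only [c1, LinearMap.comp_apply, ofOriented_single, orderedMap_single]
    refine Finsupp.single_mem_supported R _ ⟨by simp [hs.1], s, hs.2, fun x hx => ?_⟩
    obtain ⟨v, hv, rfl⟩ := List.mem_map.mp hx
    exact vertexPoint_mem_closedSimplex ((Finset.mem_sort _).mp hv)
  have hc1' : ∀ z ∈ cycles R K.toPreAbstractSimplicialComplex j,
      orderedBoundary R _ (c1 z) = 0 := by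
    rintro z ⟨-, hz⟩
    rw [LinearMap.comp_apply, ← orderedMap_orderedBoundary, orderedBoundary_ofOriented,
      LinearMap.mem_ker.mp hz, map_zero, map_zero]
  have hc2 := fun z hz => hN _ (hc1 z hz)
  have hc2' : ∀ z ∈ cycles R K.toPreAbstractSimplicialComplex j,
      orderedBoundary R _ (c2 z) = 0 := by
    intro z hz
    rw [LinearMap.comp_apply, orderedBoundary_subdivision_pow, hc1' z hz, map_zero]
  have hc3 : ∀ z ∈ cycles R K.toPreAbstractSimplicialComplex j,
      c3 z ∈ Finsupp.supported R R ({l | l.length ≤ j} ∩ smallSimplices L δ) := by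
    intro z hz
    refine orderedMap_mem_supported ?_ (hc2 z hz)
    intro l hl
    refine ⟨?_, ?_, ?_⟩
    · simpa using hl.1
    · intro y hy
      obtain ⟨x, hx, rfl⟩ := List.mem_map.mp hy
      exact hfm x (hl.2.2.1 x hx)
    · intro y hy y' hy'
      obtain ⟨x, hx, rfl⟩ := List.mem_map.mp hy
      obtain ⟨x', hx', rfl⟩ := List.mem_map.mp hy'
      exact hfδ x (hl.2.2.1 x hx) x' (hl.2.2.1 x' hx')
        (hl.2.2.2 x hx x' hx')
  have hc3' : ∀ z ∈ cycles R K.toPreAbstractSimplicialComplex j,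
      orderedBoundary R _ (c3 z) = 0 := by
    intro z hz
    rw [LinearMap.comp_apply, ← orderedMap_orderedBoundary, hc2' z hz, map_zero]
  refine ⟨orderedMap R topVertex ∘ₗ c3, fun z hz => ?_, fun z hz hFz => ?_⟩
  · exact orderedMap_mem_supported (fun l hl => by simpa using hl.1) (hc3 z hz)
  obtain ⟨d, hd, hd'⟩ := hcδ (c3 z) (Finsupp.supported_mono Set.inter_subset_right (hc3 z hz))
    (hc3' z hz) hFz
  have hgd : orderedMap R g d ∈
      Finsupp.supported R R (smallSimplices K ((Fintype.card V : ℝ)⁻¹ / 2)) := by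
    refine orderedMap_mem_supported ?_ hd
    intro l hl
    refine ⟨?_, ?_⟩
    · intro y hy
      obtain ⟨x, hx, rfl⟩ := List.mem_map.mp hy
      exact hgm x (hl.1 x hx)
    · intro y hy y' hy'
      obtain ⟨x, hx, rfl⟩ := List.mem_map.mp hy
      obtain ⟨x', hx', rfl⟩ := List.mem_map.mp hy'
      exact hgε x (hl.1 x hx) x' (hl.1 x' hx') (hl.2 x hx x' hx')
  -- As `g` undoes `f` pointwise, the filling found in `L` returns as a filling of the subdivided
  -- cycle itself.
  have hgd' : orderedBoundary R _ (orderedMap R g d) = c2 z := by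
    rw [← orderedMap_orderedBoundary, hd', LinearMap.comp_apply, orderedMap_orderedMap]
    exact orderedMap_eq_self (fun l hl x hx => hgf x (hl.2.2.1 x hx)) (hc2 z hz)
  obtain ⟨e, he, he'⟩ := exists_orderedBoundary_eq_sub_subdivision_pow (R := R)
    (P := {l | l.length ≤ j} ∩ affineSimplices K) (Q := affineSimplices K)
    (fun l hl m hm hm' => ⟨hm.trans hl.1, affineSimplices_of_mem_convexHull hl.2 hm'⟩)
    (fun l hl m hm => affineSimplices_of_mem_convexHull hl.2 hm) (hc1 z hz) (hc1' z hz) N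
  have htop : orderedMap R topVertex (orderedMap R g d + e) ∈
      Finsupp.supported R R {l | l.toFinset ∈ faces'} := by
    rw [map_add]
    refine Submodule.add_mem _ ?_ ?_
    · exact orderedMap_mem_supported
        (fun l hl => toFinset_map_topVertex hl.1 hl.2 (half_lt_self hn)) hgd
    · refine orderedMap_mem_supported ?_ he
      rintro l ⟨s, hs, hl⟩
      refine face_of_subset hs fun v hv => ?_
      obtain ⟨x, hx, rfl⟩ := List.mem_map.mp (List.mem_toFinset.mp hv)
      exact topVertex_mem (hl x hx)
  refine mem_boundaries_of_boundary_eq hz.1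
    (w := toOriented R (orderedMap R topVertex (orderedMap R g d + e))) ?_ ?_
  · refine map_mem_of_mem_supported _ (fun l hl => ?_) htop
    exact Finsupp.supported_mono (fun s hs => face_of_subset hl hs)
      (toOriented_single_mem_supported l)
  -- The two boundaries are `c2 z` and `c1 z - c2 z`, with sum `c1 z`; the vertex map and the
  -- projection to oriented chains then recover `z`.
  · rw [boundary_toOriented, ← orderedMap_orderedBoundary, map_add, hgd', he']
    have : c2 z = (subdivision R ^ N) (c1 z) := rfl
    rw [this, add_sub_cancel, LinearMap.comp_apply, orderedMap_orderedMap,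
      orderedMap_eq_self (f := topVertex ∘ vertexPoint) (P := Set.univ)
        (fun _ _ v _ => topVertex_vertexPoint v) (by simp),
      toOriented_ofOriented]

end Comparison

/-! ### Euler characteristics -/

section Rank

variable {R : Type*} [CommRing R] [IsDomain R]

/-- Over a domain that is not Noetherian a submodule need not be finitely generated, but its rank is
still finite, which is all that counting with `finrank` requires. -/
theorem rank_submodule_lt_aleph0 {M : Type*} [AddCommGroup M] [Module R M] [Module.Finite R M]
    (N : Submodule R M) : Module.rank R N < Cardinal.aleph0 :=
  (Submodule.rank_le N).trans_lt (Module.rank_lt_aleph0 R M)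

theorem finrank_submodule_mono {M : Type*} [AddCommGroup M] [Module R M] [Module.Finite R M]
    {N N' : Submodule R M} (h : N ≤ N') : Module.finrank R N ≤ Module.finrank R N' :=
  Cardinal.toNat_le_toNat (Submodule.rank_mono h) (rank_submodule_lt_aleph0 N')

theorem finrank_map_add_finrank_inf_ker {M M' : Type*} [AddCommGroup M] [Module R M]
    [Module.Finite R M] [AddCommGroup M'] [Module R M'] (f : M →ₗ[R] M') (N : Submodule R M) :
    Module.finrank R (N.map f) + Module.finrank R (N ⊓ LinearMap.ker f : Submodule R M) =
      Module.finrank R N := by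
  have h := congrArg Cardinal.toNat (LinearMap.lift_rank_range_add_rank_ker (f.domRestrict N))
  have e : LinearMap.ker (f.domRestrict N) ≃ₗ[R] (N ⊓ LinearMap.ker f : Submodule R M) := by
    refine (Submodule.equivMapOfInjective N.subtype N.injective_subtype _).trans
      (LinearEquiv.ofEq _ _ ?_)
    rw [LinearMap.ker_domRestrict, Submodule.map_comap_subtype]
  have h1 : Module.rank R (LinearMap.ker (f.domRestrict N)) < Cardinal.aleph0 :=
    e.rank_eq ▸ rank_submodule_lt_aleph0 _
  have h2 : Cardinal.lift (Module.rank R (LinearMap.range (f.domRestrict N))) <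
      Cardinal.aleph0 := by
    refine (self_le_add_right _ _).trans_lt
      ((LinearMap.lift_rank_range_add_rank_ker (f.domRestrict N)).trans_lt ?_)
    exact Cardinal.lift_lt_aleph0.mpr (rank_submodule_lt_aleph0 N)
  rw [Cardinal.toNat_add h2 (Cardinal.lift_lt_aleph0.mpr h1), Cardinal.toNat_lift,
    Cardinal.toNat_lift, Cardinal.toNat_lift, LinearMap.range_domRestrict] at h
  rw [← e.finrank_eq]
  exact h

variable {V : Type*} [Fintype V] [LinearOrder V]

theorem finrank_chains (L : PreAbstractSimplicialComplex V) (j : ℕ) :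
    Module.finrank R (chains R L j) = {s : Finset V | s.card = j ∧ (s = ∅ ∨ s ∈ L.faces)}.ncard := by
  classical
  rw [chains, (Finsupp.supportedEquivFinsupp _).finrank_eq, Module.finrank_finsupp_self,
    ← Nat.card_eq_fintype_card, Nat.card_coe_set_eq]

omit [IsDomain R] [Fintype V] in
theorem finrank_cycles_zero (L : PreAbstractSimplicialComplex V) :
    Module.finrank R (cycles R L 0) = Module.finrank R (chains R L 0) := by
  suffices cycles R L 0 = chains R L 0 by rw [this]
  refine inf_eq_left.mpr fun c hc => ?_
  refine map_mem_of_mem_supported (boundary R V) (Q := ⊥) (fun s hs => ?_) hc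
  simp [Finset.card_eq_zero.mp hs.1, boundary_single]

theorem finrank_boundaries_add_finrank_cycles (L : PreAbstractSimplicialComplex V) (j : ℕ) :
    Module.finrank R (boundaries R L j) + Module.finrank R (cycles R L (j + 1)) =
      Module.finrank R (chains R L (j + 1)) :=
  finrank_map_add_finrank_inf_ker _ _

/-- Rank–nullity for the quotient map restricted to cycles, whose kernel consists of the boundaries.
Torsion does not affect the rank. -/
theorem finrank_reducedHomology_add (L : PreAbstractSimplicialComplex V) (j : ℕ) :
    Module.finrank R (reducedHomology R L j) + Module.finrank R (boundaries R L j) =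
      Module.finrank R (cycles R L j) := by
  have := finrank_map_add_finrank_inf_ker (boundaries R L j).mkQ (cycles R L j)
  rwa [Submodule.ker_mkQ, inf_eq_right.mpr (boundaries_le_cycles L j)] at this

/-- The Euler–Poincaré formula for a truncated complex. -/
theorem sum_finrank_chains (L : PreAbstractSimplicialComplex V) (J : ℕ) :
    ∑ j ∈ Finset.range (J + 1), (-1 : ℤ) ^ j * Module.finrank R (chains R L j) =
      ∑ j ∈ Finset.range (J + 1), (-1 : ℤ) ^ j * Module.finrank R (reducedHomology R L j) +
        (-1) ^ J * Module.finrank R (boundaries R L J) := by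
  induction J with
  | zero =>
    have := finrank_reducedHomology_add (R := R) L 0
    rw [finrank_cycles_zero] at this
    simp only [zero_add, Finset.sum_range_one, pow_zero, one_mul]
    exact_mod_cast this.symm
  | succ J ih =>
    rw [Finset.sum_range_succ, ih, Finset.sum_range_succ _ (J + 1)]
    have h1 := finrank_boundaries_add_finrank_cycles (R := R) L J
    have h2 := finrank_reducedHomology_add (R := R) L (J + 1)
    zify at h1 h2
    rw [← h1, ← h2]
    ring

theorem finrank_chains_eq_zero {L : PreAbstractSimplicialComplex V} {j : ℕ}
    (h : ∀ s ∈ L.faces, s.card < j) (hj : 0 < j) : Module.finrank R (chains R L j) = 0 := by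
  rw [finrank_chains]
  convert Set.ncard_empty (Finset V)
  ext s
  simp only [Set.mem_ofPred_eq, Set.mem_empty_iff_false, iff_false, not_and, not_or]
  intro hs
  refine ⟨?_, fun hs' => absurd (h s hs') (by omega)⟩
  rintro rfl
  simp at hs
  omega

theorem finrank_boundaries_eq_zero {L : PreAbstractSimplicialComplex V} {j : ℕ}
    (h : ∀ s ∈ L.faces, s.card ≤ j) : Module.finrank R (boundaries R L j) = 0 := by
  have h1 := finrank_boundaries_add_finrank_cycles (R := R) L j
  rw [finrank_chains_eq_zero (fun s hs => Nat.lt_succ_of_le (h s hs)) j.succ_pos] at h1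
  omega

/-- The Betti numbers of a complex are bounded in terms of any complex with a homeomorphic
underlying space. -/
theorem finrank_reducedHomology_le {W : Type*} [Fintype W] [Nonempty V] [Nonempty W]
    (K : AbstractSimplicialComplex V) (L : AbstractSimplicialComplex W)
    (h : underlyingSpace K ≃ₜ underlyingSpace L) (j : ℕ) :
    Module.finrank R (reducedHomology R K.toPreAbstractSimplicialComplex j) ≤
      {l : List W | l.length ≤ j}.ncard := by
  obtain ⟨F, hF, hF'⟩ := exists_linearMap_ker_le_boundaries (R := R) K L h j
  have h1 := finrank_map_add_finrank_inf_ker F (cycles R K.toPreAbstractSimplicialComplex j)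
  have h2 := finrank_reducedHomology_add (R := R) K.toPreAbstractSimplicialComplex j
  have h3 : Module.finrank R (cycles R K.toPreAbstractSimplicialComplex j ⊓ LinearMap.ker F :
      Submodule R _) ≤ Module.finrank R (boundaries R K.toPreAbstractSimplicialComplex j) :=
    finrank_submodule_mono fun z hz => hF' z hz.1 hz.2
  have hfin : {l : List W | l.length ≤ j}.Finite := List.finite_length_le W j
  have := hfin.fintype
  let S : Submodule R (List W →₀ R) := Finsupp.supported R R {l : List W | l.length ≤ j}
  let e : S ≃ₗ[R] ({l : List W | l.length ≤ j} →₀ R) := Finsupp.supportedEquivFinsupp _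
  have h4 : Module.finrank R S = {l : List W | l.length ≤ j}.ncard := by
    rw [e.finrank_eq, Module.finrank_finsupp_self, ← Nat.card_eq_fintype_card,
      Nat.card_coe_set_eq]
  have h5 : Module.finrank R ((cycles R K.toPreAbstractSimplicialComplex j).map F) ≤
      Module.finrank R S := by
    have : Module.Finite R S := Module.Finite.equiv e.symm
    refine Cardinal.toNat_le_toNat (Submodule.rank_mono ?_) (Module.rank_lt_aleph0 R S)
    rintro _ ⟨z, hz, rfl⟩
    exact hF z hz
  -- The Betti number is `rank Z - rank B ≤ rank Z - rank (Z ⊓ ker F) = rank F(Z)`.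
  omega

end Rank

/-! ### Face numbers -/

section FaceNumbers

variable {V : Type*} [Fintype V]

open Classical in
/-- The faces of `K` with `i` vertices that contain `σ`. -/
noncomputable def cofaces (K : AbstractSimplicialComplex V) (σ : Finset V) (i : ℕ) :
    Finset (Finset V) :=
  Finset.univ.filter fun ρ => ρ ∈ K.faces ∧ σ ⊆ ρ ∧ ρ.card = i

theorem mem_cofaces {K : AbstractSimplicialComplex V} {σ ρ : Finset V} {i : ℕ} :
    ρ ∈ cofaces K σ i ↔ ρ ∈ K.faces ∧ σ ⊆ ρ ∧ ρ.card = i := by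
  simp [cofaces]

/-- Double counting of incident pairs. Positivity of `k` is needed because the empty set is not a
face. -/
theorem sum_card_cofaces (K : AbstractSimplicialComplex V) {k : ℕ} (hk : 0 < k) (i : ℕ) :
    ∑ σ ∈ cofaces K ∅ k, (cofaces K σ i).card = i.choose k * (cofaces K ∅ i).card := by
  classical
  have h1 : ∀ σ ∈ cofaces K ∅ k,
      (cofaces K σ i).card = ((cofaces K ∅ i).bipartiteAbove (· ⊆ ·) σ).card := by
    intro σ _
    congr 1
    ext ρ
    simp only [mem_cofaces, Finset.mem_bipartiteAbove, Finset.empty_subset, true_and]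
    tauto
  have h2 : ∀ ρ ∈ cofaces K ∅ i,
      ((cofaces K ∅ k).bipartiteBelow (· ⊆ ·) ρ).card = i.choose k := by
    intro ρ hρ
    obtain ⟨hρK, -, rfl⟩ := mem_cofaces.mp hρ
    rw [← Finset.card_powersetCard]
    congr 1
    ext σ
    simp only [mem_cofaces, Finset.mem_bipartiteBelow, Finset.empty_subset, true_and,
      Finset.mem_powersetCard]
    constructor
    · rintro ⟨⟨-, h⟩, h'⟩
      exact ⟨h', h⟩
    · rintro ⟨h', h⟩
      exact ⟨⟨(K.isRelLowerSet_faces hρK).2 h' (Finset.card_pos.mp (h ▸ hk)), h⟩, h'⟩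
  rw [Finset.sum_congr rfl h1, Finset.sum_card_bipartiteAbove_eq_sum_card_bipartiteBelow,
    Finset.sum_congr rfl h2, Finset.sum_const, smul_eq_mul, mul_comm]

variable [LinearOrder V] {R : Type*} [CommRing R] [IsDomain R]

/-- Joining with `σ` is a bijection from simplices of the link to cofaces; the empty simplex
corresponds to `σ` itself, so the augmentation needs no separate formula. -/
theorem finrank_chains_link {K : AbstractSimplicialComplex V} {σ : Finset V} (hσ : σ ∈ K.faces)
    (j : ℕ) : Module.finrank R (chains R (link K σ) j) = (cofaces K σ (j + σ.card)).card := by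
  rw [finrank_chains, ← Set.ncard_coe_finset]
  refine Set.ncard_congr (fun τ _ => σ ∪ τ) ?_ ?_ ?_
  · rintro τ ⟨rfl, rfl | ⟨-, hd, h⟩⟩
    · simpa [mem_cofaces] using hσ
    · rw [Finset.mem_coe, mem_cofaces, Finset.card_union_of_disjoint hd, add_comm]
      exact ⟨h, Finset.subset_union_left, rfl⟩
  · have key : ∀ τ, (τ = ∅ ∨ τ ∈ (link K σ).faces) → (σ ∪ τ) \ σ = τ := by
      rintro τ (rfl | h)
      · simp
      · exact Finset.union_sdiff_cancel_left h.2.1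
    rintro τ τ' ⟨-, h⟩ ⟨-, h'⟩ he
    rw [← key τ h, ← key τ' h', he]
  · intro ρ hρ
    obtain ⟨hρ, hσρ, hc⟩ := mem_cofaces.mp hρ
    have hu : σ ∪ ρ \ σ = ρ := Finset.union_sdiff_of_subset hσρ
    refine ⟨ρ \ σ, ⟨?_, ?_⟩, hu⟩
    · rw [Finset.card_sdiff_of_subset hσρ, hc, Nat.add_sub_cancel]
    · rcases (ρ \ σ).eq_empty_or_nonempty with h | h
      · exact Or.inl h
      · exact Or.inr ⟨h, Finset.disjoint_sdiff, hu.symm ▸ hρ⟩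

theorem finrank_chains_eq_card_cofaces (K : AbstractSimplicialComplex V) (j : ℕ) :
    Module.finrank R (chains R K.toPreAbstractSimplicialComplex (j + 1)) =
      (cofaces K ∅ (j + 1)).card := by
  rw [finrank_chains, ← Set.ncard_coe_finset]
  congr 1
  ext ρ
  simp only [Set.mem_ofPred_eq, Finset.mem_coe, mem_cofaces, Finset.empty_subset, true_and]
  constructor
  · rintro ⟨h, rfl | h'⟩
    · simp at h
    · exact ⟨h', h⟩
  · rintro ⟨h', h⟩
    exact ⟨h, Or.inr h'⟩

theorem finrank_reducedHomology_link {K : AbstractSimplicialComplex V} {n : ℕ}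
    (hK : IsClosedHomologyManifold R n K) {σ : Finset V} (hσ : σ ∈ K.faces) (j : ℕ) :
    Module.finrank R (reducedHomology R (link K σ) j) =
      if j + σ.card = n + 1 then 1 else 0 := by
  obtain ⟨h1, h2⟩ := (hK σ hσ).2 j
  split_ifs with h
  · obtain ⟨e⟩ := h1 h
    rw [e.finrank_eq, Module.finrank_self]
  · have := h2 h
    exact Module.finrank_zero_of_subsingleton

/-- The Euler characteristic of the link of a simplex in a closed homology manifold. -/
theorem sum_card_cofaces_link {K : AbstractSimplicialComplex V} {n : ℕ}
    (hK : IsClosedHomologyManifold R n K) {σ : Finset V} (hσ : σ ∈ K.faces) {k : ℕ}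
    (hk : k + σ.card = n + 1) :
    ∑ j ∈ Finset.range (k + 1), (-1 : ℤ) ^ j * (cofaces K σ (j + σ.card)).card = (-1) ^ k := by
  have h := sum_finrank_chains (R := R) (link K σ) k
  -- The dimension bound on `K` leaves no simplex of the link with more than `k` vertices, so the
  -- truncated Euler–Poincaré formula has no correction term.
  have hb : Module.finrank R (boundaries R (link K σ) k) = 0 := by
    refine finrank_boundaries_eq_zero ?_
    rintro τ ⟨-, hd, hτ⟩
    have := (hK _ hτ).1
    rw [Finset.card_union_of_disjoint hd] at this
    omega
  rw [hb] at h
  simp only [finrank_chains_link hσ, finrank_reducedHomology_link hK hσ] at h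
  rw [h, Finset.sum_eq_single_of_mem k (by simp)]
  · simp [hk]
  · intro j _ hj
    rw [if_neg (by omega)]
    simp

omit [LinearOrder V] in
theorem cofaces_self {K : AbstractSimplicialComplex V} {σ : Finset V} (hσ : σ ∈ K.faces) :
    cofaces K σ σ.card = {σ} := by
  ext ρ
  rw [mem_cofaces, Finset.mem_singleton]
  constructor
  · rintro ⟨-, h, h'⟩
    exact (Finset.eq_of_subset_of_card_le h h'.le).symm
  · rintro rfl
    exact ⟨hσ, subset_rfl, rfl⟩

theorem card_cofaces_of_card_eq_four {K : AbstractSimplicialComplex V}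
    (hK : IsClosedHomologyManifold R 4 K) {σ : Finset V} (hσ : σ ∈ K.faces) (h : σ.card = 4) :
    (cofaces K σ 5).card = 2 := by
  have h1 := sum_card_cofaces_link hK hσ (k := 1) (by omega)
  have h2 := cofaces_self hσ
  rw [h] at h1 h2
  simp only [Finset.sum_range_succ, Finset.sum_range_zero, Nat.reduceAdd, h2,
    Finset.card_singleton] at h1
  norm_num at h1
  omega

/-- The link has the Euler characteristic of a circle, so it has as many vertices as edges. Its
one-dimensional homology has rank one, so there is at least one edge. -/
theorem card_cofaces_of_card_eq_three {K : AbstractSimplicialComplex V}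
    (hK : IsClosedHomologyManifold R 4 K) {σ : Finset V} (hσ : σ ∈ K.faces) (h : σ.card = 3) :
    (cofaces K σ 4).card = (cofaces K σ 5).card ∧ 0 < (cofaces K σ 5).card := by
  have h1 := sum_card_cofaces_link hK hσ (k := 2) (by omega)
  have h2 := cofaces_self hσ
  have h3 := finrank_boundaries_add_finrank_cycles (R := R) (link K σ) 1
  have h4 := finrank_reducedHomology_add (R := R) (link K σ) 2
  rw [finrank_reducedHomology_link hK hσ, h, if_pos rfl] at h4
  rw [finrank_chains_link hσ, h] at h3
  rw [h] at h1 h2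
  simp only [Finset.sum_range_succ, Finset.sum_range_zero, Nat.reduceAdd, h2,
    Finset.card_singleton] at h1 h3 h4
  norm_num at h1
  omega

theorem card_cofaces_of_card_eq_two {K : AbstractSimplicialComplex V}
    (hK : IsClosedHomologyManifold R 4 K) {σ : Finset V} (hσ : σ ∈ K.faces) (h : σ.card = 2) :
    2 + (cofaces K σ 4).card = (cofaces K σ 3).card + (cofaces K σ 5).card := by
  have h1 := sum_card_cofaces_link hK hσ (k := 3) (by omega)
  have h2 := cofaces_self hσ
  rw [h] at h1 h2
  simp only [Finset.sum_range_succ, Finset.sum_range_zero, Nat.reduceAdd, h2,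
    Finset.card_singleton] at h1
  norm_num at h1
  omega

omit [LinearOrder V] in
theorem mem_faces_of_mem_cofaces_empty {K : AbstractSimplicialComplex V} {σ : Finset V} {k : ℕ}
    (h : σ ∈ cofaces K ∅ k) : σ ∈ K.faces ∧ σ.card = k :=
  ⟨(mem_cofaces.mp h).1, (mem_cofaces.mp h).2.2⟩

/-- The Euler characteristic bounds the number of vertices of a closed homology manifold of
dimension four in which every triangle lies in at least five simplices of dimension four. -/
theorem card_le_of_five_le_card_cofaces {K : AbstractSimplicialComplex V}
    (hK : IsClosedHomologyManifold R 4 K)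
    (h5 : ∀ σ ∈ K.faces, σ.card = 3 → 5 ≤ (cofaces K σ 5).card) :
    Fintype.card V ≤ 1 +
      Module.finrank R (reducedHomology R K.toPreAbstractSimplicialComplex 1) +
      Module.finrank R (reducedHomology R K.toPreAbstractSimplicialComplex 3) +
      Module.finrank R (reducedHomology R K.toPreAbstractSimplicialComplex 5) := by
  have hV : (cofaces K ∅ 1).card = Fintype.card V := by
    rw [← Finset.card_univ, ← Finset.card_map (f := ⟨fun v : V => ({v} : Finset V),
      Finset.singleton_injective⟩)]
    congr 1
    ext ρ
    simp only [mem_cofaces, Finset.mem_map, Finset.empty_subset, true_and, Finset.mem_univ,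
      Function.Embedding.coeFn_mk, Finset.card_eq_one]
    constructor
    · rintro ⟨-, v, rfl⟩
      exact ⟨v, rfl⟩
    · rintro ⟨v, rfl⟩
      exact ⟨K.singleton_mem v, v, rfl⟩
  have h0 : Module.finrank R (chains R K.toPreAbstractSimplicialComplex 0) = 1 := by
    rw [finrank_chains, Set.ncard_eq_one]
    refine ⟨∅, ?_⟩
    ext s
    simp only [Set.mem_ofPred_eq, Finset.card_eq_zero, Set.mem_singleton_iff]
    tauto
  -- Shifted degree `5` is the top dimension. The shifted degrees `1`, `3`, `5` kept in the bound
  -- are the dimensions `0`, `2`, `4`, whose Betti numbers enter `χ` positively.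
  have hE := sum_finrank_chains (R := R) K.toPreAbstractSimplicialComplex 5
  rw [finrank_boundaries_eq_zero (j := 5) (fun s hs => (hK s hs).1)] at hE
  have e2 : ∑ σ ∈ cofaces K ∅ 2, (2 + (cofaces K σ 4).card) =
      ∑ σ ∈ cofaces K ∅ 2, ((cofaces K σ 3).card + (cofaces K σ 5).card) :=
    Finset.sum_congr rfl fun σ hσ => card_cofaces_of_card_eq_two hK
      (mem_faces_of_mem_cofaces_empty hσ).1 (mem_faces_of_mem_cofaces_empty hσ).2
  have e4 : ∑ σ ∈ cofaces K ∅ 4, (cofaces K σ 5).card = ∑ σ ∈ cofaces K ∅ 4, 2 :=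
    Finset.sum_congr rfl fun σ hσ => card_cofaces_of_card_eq_four hK
      (mem_faces_of_mem_cofaces_empty hσ).1 (mem_faces_of_mem_cofaces_empty hσ).2
  have e3 : ∑ σ ∈ cofaces K ∅ 3, 5 ≤ ∑ σ ∈ cofaces K ∅ 3, (cofaces K σ 5).card :=
    Finset.sum_le_sum fun σ hσ => h5 σ
      (mem_faces_of_mem_cofaces_empty hσ).1 (mem_faces_of_mem_cofaces_empty hσ).2
  rw [Finset.sum_add_distrib, Finset.sum_add_distrib, sum_card_cofaces K two_pos,
    sum_card_cofaces K two_pos, sum_card_cofaces K two_pos] at e2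
  rw [sum_card_cofaces K four_pos] at e4
  rw [sum_card_cofaces K three_pos] at e3
  simp only [Finset.sum_const, smul_eq_mul] at e2 e3 e4
  norm_num [Nat.choose] at e2 e3 e4
  have f1 := finrank_chains_eq_card_cofaces (R := R) K 0
  have f2 := finrank_chains_eq_card_cofaces (R := R) K 1
  have f3 := finrank_chains_eq_card_cofaces (R := R) K 2
  have f4 := finrank_chains_eq_card_cofaces (R := R) K 3
  have f5 := finrank_chains_eq_card_cofaces (R := R) K 4
  simp only [Nat.reduceAdd] at f1 f2 f3 f4 f5
  simp only [Finset.sum_range_succ, Finset.sum_range_zero, Nat.reduceAdd, h0, f1, f2, f3, f4, f5,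
    hV] at hE
  norm_num at hE
  omega

/-! ### Triangles in rich and in flag-no-square complexes -/

theorem five_le_card_cofaces_of_isRich {K : AbstractSimplicialComplex V} (hK : IsRich 4 K)
    {σ : Finset V} (hσ : σ ∈ K.faces) (h : σ.card = 3) : 5 ≤ (cofaces K σ 5).card := by
  obtain ⟨m, hm, -, v, hv, hL⟩ := hK σ hσ (by omega)
  have : NeZero m := ⟨by omega⟩
  have : Fact (1 < m) := ⟨by omega⟩
  have hne : ∀ i : ZMod m, v i ≠ v (i + 1) := fun i hi => by simpa using hv hi
  -- This excludes that two different indices give the same edge in reversed order.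
  have htwo : (2 : ZMod m) ≠ 0 := by
    intro h2
    have := (ZMod.natCast_eq_zero_iff 2 m).mp (by exact_mod_cast h2)
    exact absurd (Nat.le_of_dvd two_pos this) (by omega)
  have hface : ∀ i : ZMod m, ({v i, v (i + 1)} : Finset V) ∈ (link K σ).faces := fun i =>
    (hL _).mpr ⟨i, Or.inr rfl⟩
  refine hm.trans ?_
  rw [← ZMod.card m, ← Finset.card_univ]
  refine Finset.card_le_card_of_injOn (fun i => σ ∪ {v i, v (i + 1)}) ?_ ?_
  · intro i _
    obtain ⟨-, hd, hi⟩ := hface i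
    rw [Finset.mem_coe, mem_cofaces, Finset.card_union_of_disjoint hd, h,
      Finset.card_pair (hne i)]
    exact ⟨hi, Finset.subset_union_left, rfl⟩
  · intro i _ k _ hik
    have he : ({v i, v (i + 1)} : Finset V) = {v k, v (k + 1)} := by
      rw [← Finset.union_sdiff_cancel_left (hface i).2.1,
        ← Finset.union_sdiff_cancel_left (hface k).2.1]
      exact congrArg (fun s : Finset V => s \ σ) hik
    have h1 : v i ∈ ({v k, v (k + 1)} : Finset V) := he ▸ by simp
    have h2 : v (i + 1) ∈ ({v k, v (k + 1)} : Finset V) := he ▸ by simp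
    simp only [Finset.mem_insert, Finset.mem_singleton, hv.eq_iff] at h1 h2
    rcases h1 with h1 | h1
    · exact h1
    · rcases h2 with h2 | h2
      · exact absurd (by linear_combination h2 - h1) htwo
      · exact add_right_cancel h2

/-- In the link of `σ`, `P` marks vertices and `G` marks edges. Vertices are counted in place of
edges, the two numbers being equal, and five distinct ones are found along a path. -/
theorem five_le_card_cofaces_of_isFlagNoSquare {K : AbstractSimplicialComplex V}
    (hK : IsClosedHomologyManifold R 4 K) (hF : IsFlagNoSquare K)
    {σ : Finset V} (hσ : σ ∈ K.faces) (h : σ.card = 3) : 5 ≤ (cofaces K σ 5).card := by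
  obtain ⟨h45, hpos⟩ := card_cofaces_of_card_eq_three hK hσ h
  let P : V → Prop := fun a => a ∉ σ ∧ insert a σ ∈ K.faces
  let G : V → V → Prop := fun a b => a ∉ σ ∧ b ∉ σ ∧ a ≠ b ∧ insert a (insert b σ) ∈ K.faces
  have hsub : ∀ {s t : Finset V}, s ∈ K.faces → t ⊆ s → t.Nonempty → t ∈ K.faces :=
    fun hs ht hne => (K.isRelLowerSet_faces hs).2 ht hne
  have hGsymm : ∀ {a b}, G a b → G b a := fun ⟨ha, hb, hab, hf⟩ =>
    ⟨hb, ha, hab.symm, Finset.insert_comm _ _ σ ▸ hf⟩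
  have hGP : ∀ {a b}, G a b → P a := fun ⟨ha, _, _, hf⟩ =>
    ⟨ha, hsub hf (Finset.insert_subset_insert _ (Finset.subset_insert _ _))
      (Finset.insert_nonempty _ _)⟩
  have hGE : ∀ {a b}, G a b → IsEdge K a b := fun ⟨_, _, hab, hf⟩ =>
    ⟨hab, hsub hf (by simp [Finset.insert_subset_iff]) (by simp)⟩
  have hPσ : ∀ {a}, P a → ∀ x ∈ σ, IsEdge K a x := fun {a} ha x hx =>
    ⟨fun hax => ha.1 (hax ▸ hx), hsub ha.2 (by simp [Finset.insert_subset_iff, hx]) (by simp)⟩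
  have hsymm : ∀ {a b}, IsEdge K a b → IsEdge K b a := fun ⟨hab, hf⟩ =>
    ⟨hab.symm, by rwa [Finset.pair_comm]⟩
  have hσσ : ∀ x ∈ σ, ∀ y ∈ σ, x ≠ y → IsEdge K x y := fun x hx y hy hxy =>
    ⟨hxy, hsub hσ (by simp [Finset.insert_subset_iff, hx, hy]) (by simp)⟩
  -- joining cliques of the link with the triangle
  have hEG : ∀ {a b}, P a → P b → IsEdge K a b → G a b := by
    intro a b ha hb hab
    refine ⟨ha.1, hb.1, hab.1, hF.1 _ (by simp) ?_⟩
    intro x hx y hy hxy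
    simp only [Finset.mem_insert] at hx hy
    rcases hx with rfl | rfl | hx <;> rcases hy with rfl | rfl | hy
    all_goals first
      | exact absurd rfl hxy
      | exact hab
      | exact hsymm hab
      | exact hPσ ha _ hy
      | exact hPσ hb _ hy
      | exact hsymm (hPσ ha _ hx)
      | exact hsymm (hPσ hb _ hx)
      | exact hσσ _ hx _ hy hxy
  -- By flagness, a triangle of edges in the link would join with `σ` to a simplex with six
  -- vertices, above the dimension.
  have htri : ∀ {a b c}, G a b → G b c → ¬ G a c := by
    intro a b c hab hbc hac
    have hmem : insert a (insert b (insert c σ)) ∈ K.faces := by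
      refine hF.1 _ (by simp) ?_
      intro x hx y hy hxy
      have ha := hGP hab
      have hb := hGP hbc
      have hc := hGP (hGsymm hbc)
      simp only [Finset.mem_insert] at hx hy
      rcases hx with rfl | rfl | rfl | hx <;> rcases hy with rfl | rfl | rfl | hy
      all_goals first
        | exact absurd rfl hxy
        | exact hGE hab
        | exact hGE hbc
        | exact hGE hac
        | exact hsymm (hGE hab)
        | exact hsymm (hGE hbc)
        | exact hsymm (hGE hac)
        | exact hPσ ha _ hy
        | exact hPσ hb _ hy
        | exact hPσ hc _ hy
        | exact hsymm (hPσ ha _ hx)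
        | exact hsymm (hPσ hb _ hx)
        | exact hsymm (hPσ hc _ hx)
        | exact hσσ _ hx _ hy hxy
    have := (hK _ hmem).1
    rw [Finset.card_insert_of_notMem (by simp [hab.1, hab.2.2.1, hac.2.2.1]),
      Finset.card_insert_of_notMem (by simp [hbc.1, hbc.2.2.1]),
      Finset.card_insert_of_notMem hbc.2.1] at this
    omega
  -- The simplex spanned by `a` and `σ` lies in two 4-simplices, so `a` has a neighbour other than
  -- any prescribed `b`.
  have hnext : ∀ {a}, P a → ∀ b, ∃ c, c ≠ b ∧ G a c := by
    intro a ha b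
    have h2 := card_cofaces_of_card_eq_four hK ha.2
      (by rw [Finset.card_insert_of_notMem ha.1, h])
    obtain ⟨ρ, hρ, hne⟩ := Finset.exists_mem_ne (by omega : 1 < (cofaces K (insert a σ) 5).card)
      (insert b (insert a σ))
    obtain ⟨hρ, hsub', hc⟩ := mem_cofaces.mp hρ
    have hcard : (ρ \ insert a σ).card = 1 := by
      rw [Finset.card_sdiff_of_subset hsub', hc, Finset.card_insert_of_notMem ha.1, h]
    obtain ⟨c, hc'⟩ := Finset.card_eq_one.mp hcard
    have hcρ : insert c (insert a σ) = ρ := by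
      rw [Finset.insert_eq, ← hc', Finset.sdiff_union_of_subset hsub']
    have hcn : c ∉ insert a σ :=
      (Finset.mem_sdiff.mp (hc' ▸ Finset.mem_singleton_self c : c ∈ ρ \ insert a σ)).2
    simp only [Finset.mem_insert, not_or] at hcn
    refine ⟨c, ?_, ha.1, hcn.2, fun hac => hcn.1 hac.symm, ?_⟩
    · rintro rfl
      exact hne hcρ.symm
    · rw [Finset.insert_comm, hcρ]
      exact hρ
  have hP4 : ∀ S : Finset V, (∀ a ∈ S, P a) → S.card ≤ (cofaces K σ 4).card := by
    intro S hS
    refine Finset.card_le_card_of_injOn (fun a => insert a σ) ?_ ?_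
    · intro a ha
      rw [Finset.mem_coe, mem_cofaces, Finset.card_insert_of_notMem (hS a ha).1, h]
      exact ⟨(hS a ha).2, Finset.subset_insert _ _, rfl⟩
    · intro a ha b _ hab
      have hab' : insert a σ = insert b σ := hab
      have : a ∈ insert b σ := hab' ▸ Finset.mem_insert_self a σ
      exact (Finset.mem_insert.mp this).resolve_right (hS a ha).1
  obtain ⟨ρ, hρ⟩ := Finset.card_pos.mp (h45 ▸ hpos)
  obtain ⟨hρ, hσρ, hρ4⟩ := mem_cofaces.mp hρ
  obtain ⟨a, haρ, ha⟩ := Finset.exists_mem_notMem_of_card_lt_card (by omega : σ.card < ρ.card)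
  have hPa : P a := ⟨ha, hsub hρ (Finset.insert_subset haρ hσρ) (by simp)⟩
  obtain ⟨b, -, hab⟩ := hnext hPa a
  obtain ⟨d, hdb, had⟩ := hnext hPa b
  obtain ⟨c, hca, hbc⟩ := hnext (hGP (hGsymm hab)) a
  have hPb := hGP hbc
  have hPc := hGP (hGsymm hbc)
  have hPd := hGP (hGsymm had)
  have hcd : c ≠ d := by
    rintro rfl
    exact htri hab hbc had
  -- An edge `c d` would close a loop of length four; its diagonal would lie in the link by flagness
  -- and create a triangle there.
  have hncd : ¬ G c d := by
    intro hcd'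
    rcases hF.2 a b c d hca.symm hdb.symm (hGE hab) (hGE hbc) (hGE hcd') (hGE (hGsymm had)) with
      h' | h'
    · exact htri hab hbc (hEG hPa hPc h')
    · exact htri (hGsymm hab) had (hEG hPb hPd h')
  obtain ⟨e, heb, hce⟩ := hnext hPc b
  have hea : e ≠ a := by
    rintro rfl
    exact htri hab hbc (hGsymm hce)
  have hed : e ≠ d := by
    rintro rfl
    exact hncd hce
  have hS := hP4 {a, b, c, d, e} (by
    simp only [Finset.mem_insert, Finset.mem_singleton]
    rintro x (rfl | rfl | rfl | rfl | rfl)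
    exacts [hPa, hPb, hPc, hPd, hGP (hGsymm hce)])
  rw [← h45]
  refine le_trans (le_of_eq ?_) hS
  rw [Finset.card_insert_of_notMem, Finset.card_insert_of_notMem, Finset.card_insert_of_notMem,
    Finset.card_pair hed.symm]
  · simp [hcd, hce.2.2.1]
  · simp [hbc.2.2.1, hdb.symm, heb.symm]
  · simp [hab.2.2.1, hca.symm, had.2.2.1, hea.symm]

end FaceNumbers

/-! ### Finiteness -/

instance {V : Type*} [Finite V] : Finite (AbstractSimplicialComplex V) :=
  Finite.of_injective (fun K => K.faces) fun K L h => by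
    cases K
    cases L
    congr
    exact PreAbstractSimplicialComplex.ext h

theorem finite_complexes_of_card_le (N : ℕ) :
    {L : Σ m : ℕ, AbstractSimplicialComplex (Fin m) | L.1 ≤ N}.Finite := by
  refine ((Set.finite_Iic N).biUnion (t := fun m => Set.range (Sigma.mk m))
    fun m _ => Set.finite_range _).subset ?_
  rintro ⟨m, L⟩ h
  simp only [Set.mem_iUnion]
  exact ⟨m, h, L, rfl⟩

/-- Every finite complex is isomorphic to one with vertices `0, …, m - 1`. -/
theorem exists_isomorphic_fin {V : Type*} [Fintype V] (K : AbstractSimplicialComplex V) :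
    ∃ L : AbstractSimplicialComplex (Fin (Fintype.card V)), Isomorphic K L := by
  classical
  let e := Fintype.equivFin V
  have hcancel : ∀ s : Finset V, (s.map e.toEmbedding).map e.symm.toEmbedding = s := fun s => by
    simp [Finset.map_map]
  refine ⟨{ faces := {s | s.map e.symm.toEmbedding ∈ K.faces}
            isRelLowerSet_faces := ?_
            singleton_mem := ?_ }, e, fun s => ?_⟩
  · intro s hs
    have h := K.isRelLowerSet_faces hs
    exact ⟨by simpa using h.1, fun t hts ht =>
      h.2 (Finset.map_subset_map.mpr hts) (by simpa using ht)⟩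
  · intro v
    simpa using K.singleton_mem (e.symm v)
  · change s ∈ K.faces ↔ (s.map e.toEmbedding).map e.symm.toEmbedding ∈ K.faces
    rw [hcancel]

/-- A topological space has, up to isomorphism, finitely many triangulations as a closed homology
manifold of dimension four in which every triangle lies in at least five simplices of dimension
four. -/
theorem finite_triangulations_of_five_le.{u, v, w} (R : Type u) [CommRing R] [IsDomain R] (M : Type v)
    [TopologicalSpace M]
    (P : ∀ (V : Type w) [Fintype V] [LinearOrder V], AbstractSimplicialComplex V → Prop)
    (hP : ∀ (V : Type w) [Fintype V] [LinearOrder V] (K : AbstractSimplicialComplex V),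
      IsClosedHomologyManifold R 4 K → P V K →
        ∀ σ ∈ K.faces, σ.card = 3 → 5 ≤ (cofaces K σ 5).card) :
    ∃ T : Set (Σ m : ℕ, AbstractSimplicialComplex (Fin m)), T.Finite ∧
      ∀ (V : Type w) [Fintype V] [LinearOrder V] (K : AbstractSimplicialComplex V),
        IsTriangulation R 4 K M → P V K → ∃ L ∈ T, Isomorphic K L.2 := by
  suffices ∃ N : ℕ, ∀ (V : Type w) [Fintype V] [LinearOrder V] (K : AbstractSimplicialComplex V),
      IsTriangulation R 4 K M → P V K → Fintype.card V ≤ N by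
    obtain ⟨N, hN⟩ := this
    refine ⟨_, finite_complexes_of_card_le N, fun V _ _ K hK hPK => ?_⟩
    obtain ⟨L, hL⟩ := exists_isomorphic_fin K
    exact ⟨⟨_, L⟩, hN V K hK hPK, hL⟩
  -- One triangulation, if there is any, is fixed as the reference for all others; its own size
  -- supplies the uniform bound.
  by_cases hex : ∃ (W : Type w) (_ : Fintype W) (_ : LinearOrder W)
      (L : AbstractSimplicialComplex W), IsTriangulation R 4 L M ∧ P W L
  · obtain ⟨W, _, _, L, hL, -⟩ := hex
    refine ⟨1 + {l : List W | l.length ≤ 1}.ncard + {l : List W | l.length ≤ 3}.ncard +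
      {l : List W | l.length ≤ 5}.ncard, fun V _ _ K hK hPK => ?_⟩
    rcases isEmpty_or_nonempty V with hV | hV
    · simp
    obtain ⟨hK'⟩ := hK.homeomorphic
    obtain ⟨hL'⟩ := hL.homeomorphic
    have h := hK'.trans hL'.symm
    -- A vertex of `K` gives a point of the underlying space of `L`, which lies in some nonempty
    -- face.
    have hW : Nonempty W := by
      obtain ⟨v⟩ := hV
      obtain ⟨-, s, hs, -⟩ := (h ⟨vertexPoint v, closedSimplex_subset_underlyingSpace
        (Or.inr (K.singleton_mem v)) (vertexPoint_mem_closedSimplex (by simp))⟩).2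
      exact (L.isRelLowerSet_faces hs).1.to_type
    have h0 := card_le_of_five_le_card_cofaces hK.isClosedHomologyManifold
      (hP V K hK.isClosedHomologyManifold hPK)
    have h1 := finrank_reducedHomology_le (R := R) K L h 1
    have h3 := finrank_reducedHomology_le (R := R) K L h 3
    have h5 := finrank_reducedHomology_le (R := R) K L h 5
    omega
  · exact ⟨0, fun V _ _ K hK hPK => absurd ⟨V, _, _, K, hK, hPK⟩ hex⟩

end HomologyManifold

theorem corollary4p2 (R : Type*) [CommRing R] [IsDomain R] (M : Type*) [TopologicalSpace M] :
    (∃ T : Set (Σ m : ℕ, AbstractSimplicialComplex (Fin m)), T.Finite ∧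
      ∀ (V : Type*) [Fintype V] [LinearOrder V] (K : AbstractSimplicialComplex V),
        HomologyManifold.IsTriangulation R 4 K M → HomologyManifold.IsRich 4 K →
          ∃ L ∈ T, HomologyManifold.Isomorphic K L.2) ∧
    (∃ T : Set (Σ m : ℕ, AbstractSimplicialComplex (Fin m)), T.Finite ∧
      ∀ (V : Type*) [Fintype V] [LinearOrder V] (K : AbstractSimplicialComplex V),
        HomologyManifold.IsTriangulation R 4 K M → HomologyManifold.IsFlagNoSquare K →
          ∃ L ∈ T, HomologyManifold.Isomorphic K L.2) := by
  refine ⟨?_, ?_⟩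
  · exact HomologyManifold.finite_triangulations_of_five_le R M
      (fun _ _ _ K => HomologyManifold.IsRich 4 K) fun _ _ _ _ _ hP _ hσ h =>
        HomologyManifold.five_le_card_cofaces_of_isRich hP hσ h
  · exact HomologyManifold.finite_triangulations_of_five_le R M
      (fun _ _ _ K => HomologyManifold.IsFlagNoSquare K) fun _ _ _ _ hK hP _ hσ h =>
        HomologyManifold.five_le_card_cofaces_of_isFlagNoSquare hK hP hσ h
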